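/- **Setting.** Let $r$ be a positive integer and let $0\le a_1,a_2,a_3,a_4,e<r$ be integers such that * $\gcd(a_i,r)\mid\gcd(e,r)$ for $1\le i\le 4$; * $\gcd(a_i,a_j,r)=1$ for $1\le i<j\le 4$; * $a_1+a_2+a_3+a_4-e\equiv 1 \pmod r$. Let $\xi\in\mathbb C$ be a primitive $r$-th root of unity, let $\mathfrak m$ be the maximal ideal of the ring $\mathbb C\{x_1,x_2,x_3,x_4\}$ of convergent power series, and let $f\in\mathbb C\{x_1,x_2,x_3,x_4\}$ satisfy $f(\xi^{a_1}x_1,\dots,\xi^{a_4}x_4)=\xi^{e}f(x_1,\dots,x_4)$ and be of one of the following types: * (cA type) $f=x_1x_2+g(x_3,x_4)$ with $g\in\mathfrak m^2$; * (odd type) $f=x_1^2+x_2^2+g(x_3,x_4)$ with $g\in\mathfrak m^3$, and $a_1\not\equiv a_2\pmod r$; * (cD-E type) $f=x_1^2+g(x_2,x_3,x_4)$ with $g\in\mathfrak m^3$. If $f$ is of cA type, assume moreover that for no integer $b$ with $\gcd(b,r)=1$ is $(a_1,a_2,a_3,a_4,e)$ congruent modulo $r$ to $(b,-b,1,0,0)$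 or to $(b,-b,0,1,0)$. Let $L=\mathbb Z^4+\mathbb Z\cdot\frac1r(a_1,a_2,a_3,a_4)\subset\mathbb Q^4$, let $\mathbf e_1,\dots,\mathbf e_4$ be the standard basis of $\mathbb Q^4$, and put $$N=\bigl(L\cap\mathbb Q^4_{\ge 0}\bigr)\setminus\{\mathbf 0,\mathbf e_1,\mathbf e_2,\mathbf e_3,\mathbf e_4\}.$$ For $\alpha\in N$ let $\alpha(x_1^{n_1}x_2^{n_2}x_3^{n_3}x_4^{n_4})=\sum_i n_i\alpha_i$, and let $\alpha(f)$ be the minimum of $\alpha(\mathbf x)$ over the monomials $\mathbf x$ that occur in $f$ with non-zero coefficient. Let $k$ be a positive integer and $\beta\in\mathbb Q^4$ such that one of the following holds: * (a) $k=1$, $\beta=\mathbf 0$, and $\alpha(x_1x_2x_3x_4)-\alpha(f)>1$ for all $\alpha\in N$; * (b) $k\ge 2$; $\beta\in N$ is primitive in $L$ (that is, $\beta\neq t w$ for all $w\in L$ and all integers $t\ge 2$); either $\frac1k<\beta(x_1x_2x_3x_4)-\beta(f)\le\min\{\frac{12}{13},\frac1{k-1}\}$, or $k=2$ and $\beta(x_1x_2x_3x_4)-\beta(f)=1$;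 and $\alpha(x_1x_2x_3x_4)-\alpha(f)>1$ for all $\alpha\in N\setminus\{\beta,2\beta,\dots,(k-1)\beta\}$. **Theorem.** For every positive integer $k$ there are finite sets $\Gamma_k\subset\mathbb N$ and $\Gamma_k'\subset\mathbb Q^4$, depending only on $k$, such that for all data $r,a_1,\dots,a_4,e,\xi,f,\beta$ as in the Setting with this $k$, either $r\in\Gamma_k$, or $\beta\ne\mathbf 0$ and $\beta\in\Gamma_k'$. -/

import Mathlib

namespace EncCDV

/-- A formal power series in `x₁, …, x₄` (indexed by `Fin 4`) is convergent if it converges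
absolutely on some polydisc of positive radius around the origin. -/
def IsConvergent (f : MvPowerSeries (Fin 4) ℂ) : Prop :=
  ∃ R : ℝ, 0 < R ∧ Summable fun n : Fin 4 →₀ ℕ => ‖MvPowerSeries.coeff n f‖ * R ^ n.degree

lemma summable_of_le {f : MvPowerSeries (Fin 4) ℂ} {R S : ℝ} (hS : 0 < S) (hSR : S ≤ R)
    (h : Summable fun n : Fin 4 →₀ ℕ => ‖MvPowerSeries.coeff n f‖ * R ^ n.degree) :
    Summable fun n : Fin 4 →₀ ℕ => ‖MvPowerSeries.coeff n f‖ * S ^ n.degree :=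
  Summable.of_nonneg_of_le (fun n => by positivity) (fun n => by gcongr) h

lemma IsConvergent.of_finite_support {f : MvPowerSeries (Fin 4) ℂ} {s : Finset (Fin 4 →₀ ℕ)}
    (h : ∀ n ∉ s, MvPowerSeries.coeff n f = 0) : IsConvergent f :=
  ⟨1, one_pos, summable_of_ne_finset_zero (s := s) fun n hn => by simp [h n hn]⟩

lemma IsConvergent.add {f g : MvPowerSeries (Fin 4) ℂ} (hf : IsConvergent f)
    (hg : IsConvergent g) : IsConvergent (f + g) := by
  obtain ⟨R, hR, hf⟩ := hf
  obtain ⟨S, hS, hg⟩ := hg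
  have hm : 0 < min R S := lt_min hR hS
  refine ⟨min R S, hm, Summable.of_nonneg_of_le (fun n => by positivity) (fun n => ?_)
    ((summable_of_le hm (min_le_left R S) hf).add (summable_of_le hm (min_le_right R S) hg))⟩
  rw [← add_mul, map_add]
  gcongr
  exact norm_add_le _ _

lemma IsConvergent.neg {f : MvPowerSeries (Fin 4) ℂ} (hf : IsConvergent f) :
    IsConvergent (-f) := by
  obtain ⟨R, hR, hf⟩ := hf
  exact ⟨R, hR, by simpa using hf⟩

lemma IsConvergent.mul {f g : MvPowerSeries (Fin 4) ℂ} (hf : IsConvergent f)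
    (hg : IsConvergent g) : IsConvergent (f * g) := by
  obtain ⟨R, hR, hf⟩ := hf
  obtain ⟨S, hS, hg⟩ := hg
  obtain ⟨T, hT, hTR, hTS⟩ : ∃ T : ℝ, 0 < T ∧ T ≤ R ∧ T ≤ S :=
    ⟨min R S, lt_min hR hS, min_le_left R S, min_le_right R S⟩
  have hf' := summable_of_le hT hTR hf
  have hg' := summable_of_le hT hTS hg
  have hfg := hf'.mul_of_nonneg hg' (fun n => by positivity) (fun n => by positivity)
  have hsum := summable_sum_mul_antidiagonal_of_summable_mul
    (f := fun n : Fin 4 →₀ ℕ => ‖MvPowerSeries.coeff n f‖ * T ^ n.degree)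
    (g := fun n : Fin 4 →₀ ℕ => ‖MvPowerSeries.coeff n g‖ * T ^ n.degree) hfg
  refine ⟨T, hT, Summable.of_nonneg_of_le (fun n => by positivity) (fun n => ?_) hsum⟩
  have hle : ‖MvPowerSeries.coeff n (f * g)‖ ≤ ∑ p ∈ Finset.HasAntidiagonal.antidiagonal n,
      ‖MvPowerSeries.coeff p.1 f * MvPowerSeries.coeff p.2 g‖ := by
    rw [MvPowerSeries.coeff_mul]
    exact norm_sum_le _ _
  refine (mul_le_mul_of_nonneg_right hle (pow_nonneg hT.le _)).trans ?_
  rw [Finset.sum_mul]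
  refine Finset.sum_le_sum fun p hp => le_of_eq ?_
  have hd : n.degree = p.1.degree + p.2.degree := by
    rw [← Finset.HasAntidiagonal.mem_antidiagonal.1 hp, map_add]
  rw [norm_mul, hd, pow_add]
  ring

/-- The ring `ℂ{x₁, x₂, x₃, x₄}` of convergent power series. -/
def ConvergentSeries : Subring (MvPowerSeries (Fin 4) ℂ) where
  carrier := {f | IsConvergent f}
  mul_mem' := IsConvergent.mul
  add_mem' := IsConvergent.add
  neg_mem' := IsConvergent.neg
  zero_mem' := IsConvergent.of_finite_support (s := ∅) fun n _ => by simp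
  one_mem' := IsConvergent.of_finite_support (s := {0}) fun n hn => by
    classical
    rw [MvPowerSeries.coeff_one, if_neg (by simpa using hn)]

/-- The maximal ideal `𝔪` of `ℂ{x₁, x₂, x₃, x₄}`: the series without constant term. -/
noncomputable def maxIdeal : Ideal ConvergentSeries :=
  RingHom.ker ((MvPowerSeries.constantCoeff (σ := Fin 4) (R := ℂ)).comp ConvergentSeries.subtype)

/-- The series `g` involves only the variables with index in `s`. -/
def InvolvesOnly (s : Set (Fin 4)) (g : ConvergentSeries) : Prop :=
  ∀ n : Fin 4 →₀ ℕ, MvPowerSeries.coeff n (g : MvPowerSeries (Fin 4) ℂ) ≠ 0 → ∀ i ∉ s, n i = 0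

open MvPowerSeries in
/-- cA type: `f = x₁x₂ + g(x₃, x₄)` with `g ∈ 𝔪²`. -/
def IsCAType (f : ConvergentSeries) : Prop :=
  ∃ g ∈ maxIdeal ^ 2, InvolvesOnly {2, 3} g ∧
    (f : MvPowerSeries (Fin 4) ℂ) = X 0 * X 1 + (g : MvPowerSeries (Fin 4) ℂ)

open MvPowerSeries in
/-- Odd type: `f = x₁² + x₂² + g(x₃, x₄)` with `g ∈ 𝔪³` and `a₁ ≢ a₂ mod r`. -/
def IsOddType (r : ℕ) (a : Fin 4 → ℕ) (f : ConvergentSeries) : Prop :=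
  (∃ g ∈ maxIdeal ^ 3, InvolvesOnly {2, 3} g ∧
    (f : MvPowerSeries (Fin 4) ℂ) = X 0 ^ 2 + X 1 ^ 2 + (g : MvPowerSeries (Fin 4) ℂ)) ∧
  ¬ a 0 ≡ a 1 [MOD r]

open MvPowerSeries in
/-- cD-E type: `f = x₁² + g(x₂, x₃, x₄)` with `g ∈ 𝔪³`. -/
def IsCDEType (f : ConvergentSeries) : Prop :=
  ∃ g ∈ maxIdeal ^ 3, InvolvesOnly {1, 2, 3} g ∧
    (f : MvPowerSeries (Fin 4) ℂ) = X 0 ^ 2 + (g : MvPowerSeries (Fin 4) ℂ)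

/-- `f(ξ^{a₁}x₁, …, ξ^{a₄}x₄) = ξ^e f(x₁, …, x₄)`. -/
def IsSemiInvariant (ξ : ℂ) (a : Fin 4 → ℕ) (e : ℕ) (f : ConvergentSeries) : Prop :=
  MvPowerSeries.rescale (fun i => ξ ^ a i) (f : MvPowerSeries (Fin 4) ℂ)
    = ξ ^ e • (f : MvPowerSeries (Fin 4) ℂ)

/-- `α(f)`, the least `α`-weight `∑ nᵢ αᵢ` of a monomial `xⁿ` that occurs in `f` with non-zero
coefficient. It is only used for `α ≥ 0` rational and `f ≠ 0`, where the infimum is a minimum. -/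
noncomputable def weight (α : Fin 4 → ℚ) (f : ConvergentSeries) : ℝ :=
  sInf ((fun n : Fin 4 →₀ ℕ => ((∑ i, (n i : ℚ) * α i : ℚ) : ℝ)) ''
    {n | MvPowerSeries.coeff n (f : MvPowerSeries (Fin 4) ℂ) ≠ 0})

/-- `α(x₁x₂x₃x₄) - α(f)`. -/
noncomputable def gap (α : Fin 4 → ℚ) (f : ConvergentSeries) : ℝ :=
  ((∑ i, α i : ℚ) : ℝ) - weight α f

/-- The lattice `ℤ⁴ + ℤ · (1/r)(a₁, a₂, a₃, a₄)` in `ℚ⁴`. -/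
def lattice (r : ℕ) (a : Fin 4 → ℕ) : Set (Fin 4 → ℚ) :=
  {w | ∃ j : ℤ, ∀ i, ∃ m : ℤ, w i = (j * a i : ℚ) / r + m}

/-- The set `N` of weights: the non-zero vectors of the lattice with non-negative coordinates,
apart from the four standard basis vectors `e₁, …, e₄`. (The weight `eᵢ` is the order of
vanishing along the coordinate hyperplane `xᵢ = 0`, and
`eᵢ(x₁x₂x₃x₄) - eᵢ(f) ≤ 1` whatever `f` is.) -/
def weights (r : ℕ) (a : Fin 4 → ℕ) : Set (Fin 4 → ℚ) :=
  {w | w ∈ lattice r a ∧ (∀ i, 0 ≤ w i) ∧ w ≠ 0 ∧ ∀ i, w ≠ Pi.single i 1}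

/-- `β` is a primitive vector of the lattice: it is not a proper integral multiple of a lattice
vector. -/
def IsPrimitive (r : ℕ) (a : Fin 4 → ℕ) (β : Fin 4 → ℚ) : Prop :=
  ∀ w ∈ lattice r a, ∀ t : ℕ, 2 ≤ t → β ≠ t • w

/-- The weight inequalities: either they hold for all weights, and `k = 1`, `β = 0`; or `k ≥ 2`
and they hold away from `β, 2β, …, (k - 1)β`, where `β` is a primitive weight with
`1/k < β(x₁x₂x₃x₄) - β(f) ≤ min {12/13, 1/(k-1)}`, or `k = 2` and
`β(x₁x₂x₃x₄) - β(f) = 1`. -/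
def EncInequalities (r : ℕ) (a : Fin 4 → ℕ) (f : ConvergentSeries) (k : ℕ)
    (β : Fin 4 → ℚ) : Prop :=
  (k = 1 ∧ β = 0 ∧ ∀ α ∈ weights r a, 1 < gap α f) ∨
  (2 ≤ k ∧ β ∈ weights r a ∧ IsPrimitive r a β ∧
    ((1 / (k : ℝ) < gap β f ∧ gap β f ≤ min (12 / 13) (1 / ((k : ℝ) - 1))) ∨
      (gap β f = 1 ∧ k = 2)) ∧
    ∀ α ∈ weights r a, (∀ t : ℕ, 1 ≤ t → t ≤ k - 1 → α ≠ t • β) → 1 < gap α f)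

/-- The numerical and analytic data under consideration. -/
structure EncSetting (k r : ℕ) (a : Fin 4 → ℕ) (e : ℕ) (ξ : ℂ) (f : ConvergentSeries)
    (β : Fin 4 → ℚ) : Prop where
  r_pos : 0 < r
  a_lt : ∀ i, a i < r
  e_lt : e < r
  gcd_dvd : ∀ i, Nat.gcd (a i) r ∣ Nat.gcd e r
  gcd_pair : ∀ i j, i < j → Nat.gcd (Nat.gcd (a i) (a j)) r = 1
  sum_sub : (∑ i, (a i : ℤ)) - e ≡ 1 [ZMOD r]
  primitiveRoot : IsPrimitiveRoot ξ r
  semiInvariant : IsSemiInvariant ξ a e f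
  type : IsCAType f ∨ IsOddType r a f ∨ IsCDEType f
  inequalities : EncInequalities r a f k β
  /-- In the cA case, up to interchanging `x₃` and `x₄`,
  `(a₁, a₂, a₃, a₄, e)` is not congruent to `(b, -b, 1, 0, 0)` modulo `r` with `b` prime to `r`. -/
  exclude : IsCAType f → ∀ b : ℤ, Int.gcd b r = 1 →
    ¬ ((a 0 : ℤ) ≡ b [ZMOD r] ∧ (a 1 : ℤ) ≡ -b [ZMOD r] ∧ (e : ℤ) ≡ 0 [ZMOD r] ∧
      (((a 2 : ℤ) ≡ 1 [ZMOD r] ∧ (a 3 : ℤ) ≡ 0 [ZMOD r]) ∨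
        ((a 2 : ℤ) ≡ 0 [ZMOD r] ∧ (a 3 : ℤ) ≡ 1 [ZMOD r])))

end EncCDV

/-
If the theorem failed, the order `r` would be unbounded. Along an ultrafilter on which `r → ∞`, the
points `j a / r` fill up, by Kronecker's theorem, the subtorus cut out by the integral relations
that `a / r` satisfies approximately. This subtorus contains a line `s ↦ s c` with `c` integral and
generic, along which the weight inequality passes to the limit: for every `s` some exponent `n` of
`f` satisfies `∑ nᵢ cᵢ = e` and `∑ ⌊s cᵢ⌋ + 1 ≤ ⌊s t⌋ + ∑ nᵢ ⌊s cᵢ⌋`, where `e` is the weight of `f`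
and `t = ∑ cᵢ - e`. Adding the inequalities at `s` and `-s` forces equality, and comparing the jumps
of both sides at `s = 1 / d` pairs the numbers `c₁, …, c₄, -e, -t` into opposites. Few cases are
left, and in each a well-chosen `s` violates the inequality. A coordinate with `cᵢ = 0` is one for
which `aᵢ / r` has bounded denominator, and the divisibility conditions bound `r` directly.
-/

namespace EncCDV

open Filter Topology

section Exponents

/-- The exponents of the monomials occurring in `f`, as functions rather than `Finsupp`s. -/
def exponents (f : ConvergentSeries) : Set (Fin 4 → ℕ) :=
  {n | MvPowerSeries.coeff (Finsupp.equivFunOnFinite.symm n) (f : MvPowerSeries (Fin 4) ℂ) ≠ 0}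

/-- The exponents of the monomials of degree at least `d` in the variables with index in `s`. -/
def tailExponents {ι : Type*} [Fintype ι] (s : Set ι) (d : ℕ) : Set (ι → ℕ) :=
  {n | (∀ i ∉ s, n i = 0) ∧ d ≤ ∑ i, n i}

lemma le_order_of_mem_maxIdeal_pow {d : ℕ} {g : ConvergentSeries} (hg : g ∈ maxIdeal ^ d) :
    (d : ℕ∞) ≤ MvPowerSeries.order (g : MvPowerSeries (Fin 4) ℂ) := by
  induction hg using Submodule.pow_induction_on_left' with
  | algebraMap r => simp
  | add x y i _ _ h₁ h₂ => exact (le_min h₁ h₂).trans MvPowerSeries.min_order_le_add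
  | mem_mul m hm i x _ h =>
    have hm' : 1 ≤ MvPowerSeries.order (m : MvPowerSeries (Fin 4) ℂ) :=
      MvPowerSeries.one_le_order_iff_constCoeff_eq_zero.2 hm
    rw [Nat.cast_succ, add_comm]
    exact (add_le_add hm' h).trans MvPowerSeries.le_order_mul

lemma mem_tailExponents_of_coeff_ne_zero {s : Set (Fin 4)} {d : ℕ} {g : ConvergentSeries}
    (hg : g ∈ maxIdeal ^ d) (hs : InvolvesOnly s g) {n : Fin 4 → ℕ} (hn : n ∈ exponents g) :
    n ∈ tailExponents s d := by
  refine ⟨fun i hi => hs _ hn i hi, le_of_not_gt fun hlt => hn ?_⟩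
  refine MvPowerSeries.coeff_of_lt_order (lt_of_lt_of_le ?_ (le_order_of_mem_maxIdeal_pow hg))
  rw [Finsupp.degree_eq_sum]
  exact_mod_cast hlt

section Add

variable {f g : ConvergentSeries} {p : MvPowerSeries (Fin 4) ℂ} {s : Set (Fin 4)} {n : Fin 4 → ℕ}

lemma mem_exponents_of_eq_add (hf : (f : MvPowerSeries (Fin 4) ℂ) = p + g)
    (hs : InvolvesOnly s g) (hp : MvPowerSeries.coeff (Finsupp.equivFunOnFinite.symm n) p ≠ 0)
    {i : Fin 4} (hi : i ∉ s) (hni : n i ≠ 0) : n ∈ exponents f := by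
  have hg : MvPowerSeries.coeff (Finsupp.equivFunOnFinite.symm n)
      (g : MvPowerSeries (Fin 4) ℂ) = 0 := by
    by_contra hg
    exact hni (hs _ hg i hi)
  rwa [exponents, Set.mem_ofPred_eq, hf, map_add, hg, add_zero]

lemma mem_exponents_of_eq_add_of_coeff_eq_zero (hf : (f : MvPowerSeries (Fin 4) ℂ) = p + g)
    (hp : MvPowerSeries.coeff (Finsupp.equivFunOnFinite.symm n) p = 0) (hn : n ∈ exponents f) :
    n ∈ exponents g := by
  rwa [exponents, Set.mem_ofPred_eq, hf, map_add, hp, zero_add] at hn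

end Add

lemma coeff_X_zero_mul_X_one (n : Fin 4 → ℕ) :
    MvPowerSeries.coeff (Finsupp.equivFunOnFinite.symm n)
      (MvPowerSeries.X 0 * MvPowerSeries.X 1 : MvPowerSeries (Fin 4) ℂ) =
        if n = ![1, 1, 0, 0] then 1 else 0 := by
  classical
  rw [MvPowerSeries.X_def, MvPowerSeries.X_def, MvPowerSeries.monomial_mul_monomial,
    MvPowerSeries.coeff_monomial, mul_one]
  congr 1
  rw [Equiv.symm_apply_eq]
  refine propext ⟨fun h => h.trans ?_, fun h => h.trans ?_⟩ <;>
  · funext i; fin_cases i <;> simp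

lemma coeff_X_sq (n : Fin 4 → ℕ) (i : Fin 4) :
    MvPowerSeries.coeff (Finsupp.equivFunOnFinite.symm n)
      (MvPowerSeries.X i ^ 2 : MvPowerSeries (Fin 4) ℂ) = if n = Pi.single i 2 then 1 else 0 := by
  classical
  rw [MvPowerSeries.coeff_X_pow]
  congr 1
  rw [Equiv.symm_apply_eq, Finsupp.equivFunOnFinite_single]

lemma IsCAType.mem_exponents {f : ConvergentSeries} (hf : IsCAType f) :
    ![1, 1, 0, 0] ∈ exponents f := by
  obtain ⟨g, -, hs, hfg⟩ := hf
  exact mem_exponents_of_eq_add hfg hs (by simp [coeff_X_zero_mul_X_one]) (i := 0) (by simp)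
    (by simp)

/-- The exponents that may occur in an equation `x₁x₂ + g(x₃, x₄)` with `g ∈ 𝔪²`. -/
def caExponents : Set (Fin 4 → ℕ) := insert ![1, 1, 0, 0] (tailExponents {2, 3} 2)

lemma IsCAType.exponents_subset {f : ConvergentSeries} (hf : IsCAType f) :
    exponents f ⊆ caExponents := by
  obtain ⟨g, hg, hs, hfg⟩ := hf
  refine fun n hn => or_iff_not_imp_left.2 fun hne => mem_tailExponents_of_coeff_ne_zero hg hs
    (mem_exponents_of_eq_add_of_coeff_eq_zero hfg ?_ hn)
  rw [coeff_X_zero_mul_X_one, if_neg hne]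

/-- `f = x₁² + x₂² + g(x₃, x₄)` with `g ∈ 𝔪³`: the odd type without its congruence condition. -/
def IsSumSqType (f : ConvergentSeries) : Prop :=
  ∃ g ∈ maxIdeal ^ 3, InvolvesOnly {2, 3} g ∧ (f : MvPowerSeries (Fin 4) ℂ) =
    MvPowerSeries.X 0 ^ 2 + MvPowerSeries.X 1 ^ 2 + (g : MvPowerSeries (Fin 4) ℂ)

lemma IsSumSqType.mem_exponents {f : ConvergentSeries} (hf : IsSumSqType f) :
    Pi.single 0 2 ∈ exponents f ∧ Pi.single 1 2 ∈ exponents f := by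
  obtain ⟨g, -, hs, hfg⟩ := hf
  constructor
  · refine mem_exponents_of_eq_add hfg hs ?_ (i := 0) (by simp) (by simp)
    rw [map_add, coeff_X_sq, coeff_X_sq, if_pos rfl]
    split_ifs <;> norm_num
  · refine mem_exponents_of_eq_add hfg hs ?_ (i := 1) (by simp) (by simp)
    rw [map_add, coeff_X_sq, coeff_X_sq, if_pos rfl]
    split_ifs <;> norm_num

/-- The exponents that may occur in an equation `x₁² + x₂² + g(x₃, x₄)` with `g ∈ 𝔪³`. -/
def sumSqExponents : Set (Fin 4 → ℕ) :=
  {Pi.single 0 2, Pi.single 1 2} ∪ tailExponents {2, 3} 3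

lemma IsSumSqType.exponents_subset {f : ConvergentSeries} (hf : IsSumSqType f) :
    exponents f ⊆ sumSqExponents := by
  obtain ⟨g, hg, hs, hfg⟩ := hf
  refine fun n hn => or_iff_not_imp_left.2 fun hne => mem_tailExponents_of_coeff_ne_zero hg hs
    (mem_exponents_of_eq_add_of_coeff_eq_zero hfg ?_ hn)
  obtain ⟨h₀, h₁ : n ≠ Pi.single 1 2⟩ := not_or.1 hne
  rw [map_add, coeff_X_sq, coeff_X_sq, if_neg h₀, if_neg h₁, add_zero]

lemma IsCDEType.mem_exponents {f : ConvergentSeries} (hf : IsCDEType f) :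
    Pi.single 0 2 ∈ exponents f := by
  obtain ⟨g, -, hs, hfg⟩ := hf
  exact mem_exponents_of_eq_add hfg hs (by rw [coeff_X_sq]; simp) (i := 0) (by simp) (by simp)

/-- The exponents that may occur in an equation `x₁² + g(x₂, x₃, x₄)` with `g ∈ 𝔪³`. -/
def cdeExponents : Set (Fin 4 → ℕ) := insert (Pi.single 0 2) (tailExponents {1, 2, 3} 3)

lemma IsCDEType.exponents_subset {f : ConvergentSeries} (hf : IsCDEType f) :
    exponents f ⊆ cdeExponents := by
  obtain ⟨g, hg, hs, hfg⟩ := hf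
  refine fun n hn => or_iff_not_imp_left.2 fun hne => mem_tailExponents_of_coeff_ne_zero hg hs
    (mem_exponents_of_eq_add_of_coeff_eq_zero hfg ?_ hn)
  rw [coeff_X_sq, if_neg hne]

lemma dvd_sum_sub_of_mem_exponents {r : ℕ} {ξ : ℂ} (hξ : IsPrimitiveRoot ξ r) (hr : 0 < r)
    {a : Fin 4 → ℕ} {e : ℕ} {f : ConvergentSeries} (hf : IsSemiInvariant ξ a e f)
    {n : Fin 4 → ℕ} (hn : n ∈ exponents f) : (r : ℤ) ∣ ∑ i, (n i : ℤ) * a i - e := by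
  have hcoeff := congrArg (MvPowerSeries.coeff (Finsupp.equivFunOnFinite.symm n)) hf
  rw [MvPowerSeries.coeff_rescale, MvPowerSeries.coeff_smul] at hcoeff
  have hpow : ξ ^ (∑ i, a i * n i) = ξ ^ e := by
    have h := mul_right_cancel₀ hn hcoeff
    rwa [Finsupp.prod_fintype _ _ (by simp), Finset.prod_congr rfl fun i _ => (pow_mul ξ _ _).symm,
      Finset.prod_pow_eq_pow_sum] at h
  have hξ₀ : ξ ≠ 0 := hξ.ne_zero hr.ne'
  refine (hξ.zpow_eq_one_iff_dvd _).1 ?_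
  rw [zpow_sub₀ hξ₀, div_eq_one_iff_eq (zpow_ne_zero _ hξ₀)]
  exact_mod_cast by simpa only [mul_comm] using hpow

end Exponents

/-- The arithmetic content of the setting: `ε` is an integral linear form representing the weight
`e` of the equation, `S` is the set of exponents of the equation, and on each translate by
`b ∈ ℕ^ι` of the weights `({j aᵢ / r})ᵢ`, the weight inequality holds up to `k` values of `j`.
The term `j / r` in it is what a strict inequality gains from integrality. -/
structure Admissible {ι : Type*} [Fintype ι] (k r : ℕ) (a ε : ι → ℤ) (S : Set (ι → ℕ)) :
    Prop where
  r_pos : 0 < r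
  dvd_exponent : ∀ n ∈ S, (r : ℤ) ∣ ∑ i, ((n i : ℤ) - ε i) * a i
  dvd_sum_sub_one : (r : ℤ) ∣ ∑ i, (1 - ε i) * a i - 1
  dvd_of_dvd_mul : ∀ i j, i ≠ j → ∀ m : ℤ, (r : ℤ) ∣ m * a i → (r : ℤ) ∣ m * a j → (r : ℤ) ∣ m
  dvd_mul_sum : ∀ i, ∀ m : ℤ, (r : ℤ) ∣ m * a i → (r : ℤ) ∣ m * ∑ i, ε i * a i
  exists_exceptions : ∀ b : ι → ℕ, ∃ J : Finset ℕ, J.card ≤ k ∧ ∀ j : ℕ, 0 < j → j < r → j ∉ J →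
    ∃ n ∈ S, ∑ i, (n i : ℝ) * (Int.fract ((j * a i : ℝ) / r) + b i) + 1 + (j : ℝ) / r
      ≤ ∑ i, (Int.fract ((j * a i : ℝ) / r) + b i)

section Divisibility

lemma dvd_of_dvd_mul_of_gcd {r x y : ℕ} {m : ℤ} (h : Nat.gcd (Nat.gcd x y) r = 1)
    (hx : (r : ℤ) ∣ m * x) (hy : (r : ℤ) ∣ m * y) : (r : ℤ) ∣ m := by
  have hgcd : r ∣ m.natAbs * Nat.gcd x y := by
    rw [← Nat.gcd_mul_left]
    exact Nat.dvd_gcd (by simpa [Int.natAbs_mul] using Int.natCast_dvd.1 hx)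
      (by simpa [Int.natAbs_mul] using Int.natCast_dvd.1 hy)
  exact Int.natCast_dvd.2 ((Nat.Coprime.symm h).dvd_of_dvd_mul_right hgcd)

lemma dvd_mul_of_gcd_dvd {r x e : ℕ} {m : ℤ} (h : Nat.gcd x r ∣ e) (hx : (r : ℤ) ∣ m * x) :
    (r : ℤ) ∣ m * e := by
  have hgcd : r ∣ m.natAbs * Nat.gcd x r := by
    rw [← Nat.gcd_mul_left]
    exact Nat.dvd_gcd (by simpa [Int.natAbs_mul] using Int.natCast_dvd.1 hx) (dvd_mul_left _ _)
  refine Int.natCast_dvd.2 ?_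
  rw [Int.natAbs_mul, Int.natAbs_natCast]
  exact hgcd.trans (mul_dvd_mul_left _ h)

end Divisibility

section FractWeight

/-- The lattice vector with coordinates `{j aᵢ / r} + bᵢ`. -/
def fractWeight (r : ℕ) (a b : Fin 4 → ℕ) (j : ℕ) : Fin 4 → ℚ :=
  fun i => Int.fract ((j * a i : ℚ) / r) + b i

variable {r : ℕ} {a b : Fin 4 → ℕ}

lemma exists_fractWeight_eq_div_add (j : ℕ) :
    ∃ z : Fin 4 → ℤ, ∀ i, fractWeight r a b j i = (j * a i : ℚ) / r + z i :=
  ⟨fun i => b i - ⌊(j * a i : ℚ) / r⌋, fun i => by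
    rw [fractWeight, ← Int.self_sub_floor]; push_cast; ring⟩

lemma fractWeight_nonneg (j : ℕ) (i : Fin 4) : 0 ≤ fractWeight r a b j i :=
  add_nonneg (Int.fract_nonneg _) (Nat.cast_nonneg _)

lemma dvd_mul_of_fractWeight_sub_eq_intCast (hr : 0 < r) {j j' : ℕ} {i : Fin 4} {m : ℤ}
    (h : fractWeight r a b j i - fractWeight r a b j' i = m) : (r : ℤ) ∣ ((j : ℤ) - j') * a i := by
  obtain ⟨z, hz⟩ := exists_fractWeight_eq_div_add (r := r) (a := a) (b := b) j
  obtain ⟨z', hz'⟩ := exists_fractWeight_eq_div_add (r := r) (a := a) (b := b) j'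
  rw [hz, hz'] at h
  have hmul : ((j : ℚ) - j') * a i = r * (m - z i + z' i) := by
    field_simp at h
    linarith
  exact ⟨m - z i + z' i, by exact_mod_cast hmul⟩

variable (hr : 0 < r)
  (hpair : ∀ i j, i ≠ j → ∀ m : ℤ, (r : ℤ) ∣ m * a i → (r : ℤ) ∣ m * a j → (r : ℤ) ∣ m)

include hr hpair in
lemma eq_of_fractWeight_sub_eq_intCast {j j' : ℕ} (hj : j < r) (hj' : j' < r)
    (h : ∀ i, ∃ m : ℤ, fractWeight r a b j i - fractWeight r a b j' i = m) : j = j' := by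
  obtain ⟨m₀, h₀⟩ := h 0
  obtain ⟨m₁, h₁⟩ := h 1
  have hdvd : (r : ℤ) ∣ (j : ℤ) - j' := hpair 0 1 (by decide) _
    (dvd_mul_of_fractWeight_sub_eq_intCast hr h₀) (dvd_mul_of_fractWeight_sub_eq_intCast hr h₁)
  have := Int.eq_zero_of_abs_lt_dvd hdvd (by rw [abs_lt]; omega)
  omega

include hr hpair in
lemma injOn_fractWeight : Set.InjOn (fractWeight r a b) (Set.Iio r) :=
  fun _ hj _ hj' h => eq_of_fractWeight_sub_eq_intCast (b := b) hr hpair hj hj' fun _ =>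
    ⟨0, by rw [h, sub_self, Int.cast_zero]⟩

include hr hpair in
lemma fractWeight_mem_weights {j : ℕ} (h₀ : 0 < j) (hj : j < r) :
    fractWeight r a b j ∈ weights r a := by
  have hne : ¬ ∀ i, ∃ m : ℤ, fractWeight r a b j i = m := fun h =>
    h₀.ne' (eq_of_fractWeight_sub_eq_intCast (b := b) hr hpair hj hr fun i => by
      obtain ⟨m, hm⟩ := h i
      exact ⟨m - b i, by rw [hm]; simp [fractWeight]⟩)
  refine ⟨?_, fractWeight_nonneg j, fun h => hne fun i => ⟨0, by simp [h]⟩,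
    fun i h => hne fun i' => ⟨if i' = i then 1 else 0, ?_⟩⟩
  · obtain ⟨z, hz⟩ := exists_fractWeight_eq_div_add (r := r) (a := a) (b := b) j
    exact ⟨j, fun i => ⟨z i, by simp [hz]⟩⟩
  · rw [h, Pi.single_apply]
    split_ifs <;> simp

lemma exists_sum_fractWeight_sub_eq {e : ℕ} {n : Fin 4 → ℕ} (hr : 0 < r)
    (hsum : (r : ℤ) ∣ (∑ i, (a i : ℤ)) - e - 1) (hn : (r : ℤ) ∣ ∑ i, (n i : ℤ) * a i - e) (j : ℕ) :
    ∃ q : ℤ, ∑ i, fractWeight r a b j i - ∑ i, (n i : ℚ) * fractWeight r a b j i =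
      (j : ℚ) / r + q := by
  obtain ⟨z, hz⟩ := exists_fractWeight_eq_div_add (r := r) (a := a) (b := b) j
  obtain ⟨u, hu⟩ := hsum
  obtain ⟨v, hv⟩ := hn
  have huQ : ∑ i, (a i : ℚ) = e + 1 + r * u := by
    rw [← sub_eq_iff_eq_add', ← sub_sub]; exact_mod_cast hu
  have hvQ : ∑ i, (n i : ℚ) * a i = e + r * v := by
    rw [← sub_eq_iff_eq_add']; exact_mod_cast hv
  refine ⟨j * (u - v) + ∑ i, z i - ∑ i, n i * z i, ?_⟩
  calc ∑ i, fractWeight r a b j i - ∑ i, (n i : ℚ) * fractWeight r a b j i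
      = (j : ℚ) / r * (∑ i, (a i : ℚ) - ∑ i, (n i : ℚ) * a i) + ∑ i, (z i : ℚ)
          - ∑ i, (n i : ℚ) * z i := by
        simp only [hz, Fin.sum_univ_four]; ring
    _ = _ := by
        rw [huQ, hvQ]; push_cast; field_simp; ring

end FractWeight

section Gap

lemma exists_exponent_of_one_lt_gap {α : Fin 4 → ℚ} {f : ConvergentSeries}
    (hf : (exponents f).Nonempty) (h : 1 < gap α f) :
    ∃ n ∈ exponents f, ∑ i, (n i : ℚ) * α i + 1 < ∑ i, α i := by
  obtain ⟨n₀, hn₀⟩ := hf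
  have hlt : weight α f < ((∑ i, α i : ℚ) : ℝ) - 1 := by rw [gap] at h; linarith
  rw [weight] at hlt
  have hne : {n | MvPowerSeries.coeff n (f : MvPowerSeries (Fin 4) ℂ) ≠ 0}.Nonempty := ⟨_, hn₀⟩
  obtain ⟨_, ⟨n, hn, rfl⟩, hlt⟩ := exists_lt_of_csInf_lt (hne.image _) hlt
  refine ⟨n, ?_, ?_⟩
  · rwa [exponents, Set.mem_ofPred_eq, Finsupp.equivFunOnFinite_symm_coe]
  · have hlt' : ((∑ i, (n i : ℚ) * α i : ℚ) : ℝ) + 1 < ((∑ i, α i : ℚ) : ℝ) :=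
      lt_sub_iff_add_lt.1 hlt
    exact_mod_cast hlt'

variable {k r e : ℕ} {a : Fin 4 → ℕ} {ξ : ℂ} {f : ConvergentSeries}

lemma exists_exponent_sum_fractWeight_le (hξ : IsPrimitiveRoot ξ r)
    (hf : IsSemiInvariant ξ a e f) (hsum : (r : ℤ) ∣ (∑ i, (a i : ℤ)) - e - 1)
    (hne : (exponents f).Nonempty) {b : Fin 4 → ℕ} {j : ℕ} (hj : j < r)
    (hgap : 1 < gap (fractWeight r a b j) f) :
    ∃ n ∈ exponents f, ∑ i, (n i : ℚ) * fractWeight r a b j i + 1 + (j : ℚ) / r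
      ≤ ∑ i, fractWeight r a b j i := by
  have hr : 0 < r := by omega
  obtain ⟨n, hn, hlt⟩ := exists_exponent_of_one_lt_gap hne hgap
  obtain ⟨q, hq⟩ := exists_sum_fractWeight_sub_eq (b := b) hr hsum
    (dvd_sum_sub_of_mem_exponents hξ hr hf hn) j
  have hjr : (j : ℚ) / r < 1 := by
    rw [div_lt_one (by positivity)]; exact_mod_cast hj
  have hq₁ : (1 : ℚ) ≤ q := by
    have : (0 : ℚ) < q := by linarith
    exact_mod_cast this
  exact ⟨n, hn, by linarith⟩

lemma cast_fractWeight (b : Fin 4 → ℕ) (j : ℕ) (i : Fin 4) :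
    ((fractWeight r a b j i : ℚ) : ℝ) = Int.fract ((j * (a i : ℤ) : ℝ) / r) + b i := by
  rw [fractWeight, Rat.cast_add, Rat.cast_fract]
  push_cast
  rfl

lemma exists_exceptional_indices (hr : 0 < r)
    (hpair : ∀ i j, i ≠ j → ∀ m : ℤ, (r : ℤ) ∣ m * a i → (r : ℤ) ∣ m * a j → (r : ℤ) ∣ m)
    {P : (Fin 4 → ℚ) → Prop} {X : Finset (Fin 4 → ℚ)} (hX : X.card ≤ k)
    (hP : ∀ α ∈ weights r a, α ∉ X → P α) (b : Fin 4 → ℕ) :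
    ∃ J : Finset ℕ, J.card ≤ k ∧ ∀ j : ℕ, 0 < j → j < r → j ∉ J → P (fractWeight r a b j) := by
  classical
  refine ⟨(Finset.range r).filter fun j => fractWeight r a b j ∈ X, ?_, fun j h₀ hj hJ =>
    hP _ (fractWeight_mem_weights hr hpair h₀ hj) fun h => hJ (by simp [hj, h])⟩
  refine (Finset.card_le_card_of_injOn (fractWeight r a b)
    (fun j hj => (Finset.mem_filter.1 hj).2) fun j hj j' hj' => ?_).trans hX
  exact injOn_fractWeight hr hpair (Finset.mem_range.1 (Finset.mem_filter.1 hj).1)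
    (Finset.mem_range.1 (Finset.mem_filter.1 hj').1)

lemma admissible_of_one_lt_gap (hr : 0 < r) (hgcd : ∀ i, Nat.gcd (a i) r ∣ Nat.gcd e r)
    (hpair : ∀ i j, i < j → Nat.gcd (Nat.gcd (a i) (a j)) r = 1)
    (hsum : (∑ i, (a i : ℤ)) - e ≡ 1 [ZMOD r]) (hξ : IsPrimitiveRoot ξ r)
    (hf : IsSemiInvariant ξ a e f) {X : Finset (Fin 4 → ℚ)} (hX : X.card ≤ k)
    (hgap : ∀ α ∈ weights r a, α ∉ X → 1 < gap α f) {n₀ : Fin 4 → ℕ} (hn₀ : n₀ ∈ exponents f) :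
    Admissible k r (fun i => a i) (fun i => n₀ i) (exponents f) := by
  have hsum' := Int.modEq_iff_dvd.1 hsum.symm
  have hpair' : ∀ i j, i ≠ j → ∀ m : ℤ, (r : ℤ) ∣ m * a i → (r : ℤ) ∣ m * a j → (r : ℤ) ∣ m := by
    intro i j hij m hi hj
    rcases lt_or_gt_of_ne hij with hlt | hlt
    · exact dvd_of_dvd_mul_of_gcd (hpair i j hlt) hi hj
    · exact dvd_of_dvd_mul_of_gcd (hpair j i hlt) hj hi
  have hdvd := fun n (hn : n ∈ exponents f) => dvd_sum_sub_of_mem_exponents hξ hr hf hn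
  refine ⟨hr, fun n hn => ?_, ?_, hpair', fun i m hm => ?_, fun b => ?_⟩
  · simpa only [sub_mul, Finset.sum_sub_distrib, sub_sub_sub_cancel_right] using
      dvd_sub (hdvd n hn) (hdvd n₀ hn₀)
  · refine (dvd_sub hsum' (hdvd n₀ hn₀)).trans (dvd_of_eq ?_)
    simp only [sub_mul, one_mul, Finset.sum_sub_distrib]
    ring
  · refine (dvd_add (dvd_mul_of_gcd_dvd ((hgcd i).trans (Nat.gcd_dvd_left e r)) hm)
      ((hdvd n₀ hn₀).mul_left m)).trans (dvd_of_eq ?_)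
    ring
  · obtain ⟨J, hJ, hJgap⟩ := exists_exceptional_indices hr hpair' hX hgap b
    refine ⟨J, hJ, fun j h₀ hj hjJ => ?_⟩
    obtain ⟨n, hn, hle⟩ :=
      exists_exponent_sum_fractWeight_le hξ hf hsum' ⟨n₀, hn₀⟩ hj (hJgap j h₀ hj hjJ)
    refine ⟨n, hn, ?_⟩
    simp only [← cast_fractWeight]
    have hleR := (Rat.cast_le (K := ℝ)).2 hle
    push_cast at hleR
    exact hleR

lemma EncInequalities.exists_exceptions {β : Fin 4 → ℚ} (h : EncInequalities r a f k β) :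
    ∃ X : Finset (Fin 4 → ℚ), X.card ≤ k ∧ ∀ α ∈ weights r a, α ∉ X → 1 < gap α f := by
  rcases h with ⟨-, -, h⟩ | ⟨hk, -, -, -, h⟩
  · exact ⟨∅, by simp, fun α hα _ => h α hα⟩
  · classical
    refine ⟨(Finset.range k).image fun t => t • β, Finset.card_image_le.trans (by simp),
      fun α hα hX => h α hα fun t _ ht he => hX ?_⟩
    exact Finset.mem_image.2 ⟨t, Finset.mem_range.2 (by omega), he.symm⟩

end Gap

/-- The kernel `cos² (π u)`, of period one and peaked at the integers. Its powers are trigonometric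
polynomials with positive coefficients, which detect the points of a cyclic subgroup of the torus
near a given point. -/
noncomputable def cosKernel (u : ℝ) : ℝ := (1 + Real.cos (2 * Real.pi * u)) / 2

lemma cosKernel_nonneg (u : ℝ) : 0 ≤ cosKernel u := by
  have := Real.neg_one_le_cos (2 * Real.pi * u)
  rw [cosKernel]; linarith

lemma cosKernel_le_one (u : ℝ) : cosKernel u ≤ 1 := by
  have := Real.cos_le_one (2 * Real.pi * u)
  rw [cosKernel]; linarith

lemma cosKernel_lt_one {ε : ℝ} (h0 : 0 < ε) (h1 : ε ≤ 1 / 2) : cosKernel ε < 1 := by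
  have h : Real.cos (2 * Real.pi * ε) < Real.cos 0 :=
    Real.cos_lt_cos_of_nonneg_of_le_pi le_rfl (by nlinarith [Real.pi_pos]) (by positivity)
  rw [Real.cos_zero] at h
  rw [cosKernel]; linarith

lemma cosKernel_eq_norm (u : ℝ) : cosKernel u = cosKernel ‖(u : UnitAddCircle)‖ := by
  have h2 : 2 * Real.pi * |u - round u| = |2 * Real.pi * u - (round u : ℤ) * (2 * Real.pi)| := by
    rw [← abs_of_pos Real.two_pi_pos, ← abs_mul, abs_of_pos Real.two_pi_pos]
    ring_nf
  rw [cosKernel, cosKernel, UnitAddCircle.norm_eq, h2, Real.cos_abs, Real.cos_sub_int_mul_two_pi]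

lemma cosKernel_le_of_le_norm {ε u : ℝ} (h0 : 0 < ε) (hu : ε ≤ ‖(u : UnitAddCircle)‖) :
    cosKernel u ≤ cosKernel ε := by
  have hle : ‖(u : UnitAddCircle)‖ ≤ 1 / 2 := by
    rw [UnitAddCircle.norm_eq]; exact abs_sub_round u
  have hcos : Real.cos (2 * Real.pi * ‖(u : UnitAddCircle)‖) ≤ Real.cos (2 * Real.pi * ε) :=
    Real.cos_le_cos_of_nonneg_of_le_pi (by positivity) (by nlinarith [Real.pi_pos]) (by gcongr)
  rw [cosKernel_eq_norm u, cosKernel, cosKernel]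
  linarith

lemma cosKernel_eq_exp (u : ℝ) :
    (cosKernel u : ℂ) = Complex.exp (-(2 * Real.pi * Complex.I * u)) *
      (Complex.exp (2 * Real.pi * Complex.I * u) + 1) ^ 2 / 4 := by
  have h : Complex.exp (-(2 * Real.pi * Complex.I * u)) *
      Complex.exp (2 * Real.pi * Complex.I * u) = 1 := by
    rw [← Complex.exp_add]; simp
  rw [cosKernel]
  push_cast
  rw [Complex.cos, show (2 * Real.pi * u : ℂ) * Complex.I = 2 * Real.pi * Complex.I * u by ring,
    show -(2 * Real.pi * u : ℂ) * Complex.I = -(2 * Real.pi * Complex.I * u) by ring]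
  linear_combination (-(1 / 4) * Complex.exp (2 * Real.pi * Complex.I * u) - 1 / 2) * h

lemma cosKernel_pow_eq_sum (m : ℕ) (u : ℝ) :
    ((cosKernel u ^ m : ℝ) : ℂ) =
      ∑ p ∈ Finset.range (2 * m + 1), (((2 * m).choose p / 4 ^ m : ℝ) : ℂ) *
        Complex.exp (2 * Real.pi * Complex.I * (((p : ℤ) - m : ℤ) * u)) := by
  rw [Complex.ofReal_pow, cosKernel_eq_exp, div_pow, mul_pow, ← pow_mul, add_pow, Finset.mul_sum,
    Finset.sum_div]
  refine Finset.sum_congr rfl fun p _ => ?_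
  rw [one_pow, mul_one, ← Complex.exp_nat_mul, ← Complex.exp_nat_mul,
    show (2 * Real.pi * Complex.I * (((p : ℤ) - m : ℤ) * u) : ℂ) =
      (m : ℂ) * -(2 * Real.pi * Complex.I * u) + p * (2 * Real.pi * Complex.I * u) by
        push_cast; ring, Complex.exp_add]
  push_cast
  ring

lemma sum_exp_eq_ite {r : ℕ} (hr : 0 < r) (w : ℤ) :
    ∑ j ∈ Finset.range r, Complex.exp (2 * Real.pi * Complex.I * (j * (w / r))) =
      if (r : ℤ) ∣ w then (r : ℂ) else 0 := by
  have hr0 : (r : ℂ) ≠ 0 := by exact_mod_cast hr.ne'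
  set z := Complex.exp (2 * Real.pi * Complex.I * (w / r)) with hz
  have hpow (j : ℕ) : Complex.exp (2 * Real.pi * Complex.I * (j * (w / r))) = z ^ j := by
    rw [hz, ← Complex.exp_nat_mul]; ring_nf
  have hz1 : z = 1 ↔ (r : ℤ) ∣ w := by
    rw [hz, Complex.exp_eq_one_iff]
    refine exists_congr fun q => ?_
    rw [mul_comm (q : ℂ), mul_right_inj' Complex.two_pi_I_ne_zero, div_eq_iff hr0, mul_comm]
    norm_cast
  simp only [hpow]
  split_ifs with h
  · simp [hz1.2 h]
  · rw [geom_sum_eq (hz1.not.2 h), ← hpow, Complex.exp_eq_one_iff.2 ⟨w, by field_simp⟩]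
    simp

lemma prod_cosKernel_pow_le_one {ι : Type*} (m : ℕ) (s : Finset ι) (u : ι → ℝ) :
    ∏ i ∈ s, cosKernel (u i) ^ m ≤ 1 :=
  Finset.prod_le_one (fun _ _ => pow_nonneg (cosKernel_nonneg _) _)
    fun _ _ => pow_le_one₀ (cosKernel_nonneg _) (cosKernel_le_one _)

section Kronecker

variable {α ι : Type*} [Fintype ι]

lemma prod_cosKernel_pow_le_pow (m : ℕ) {ε : ℝ} (hε : 0 < ε) {u : ι → ℝ} {i : ι}
    (hi : ε ≤ ‖(u i : UnitAddCircle)‖) : ∏ i, cosKernel (u i) ^ m ≤ cosKernel ε ^ m := by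
  classical
  rw [← Finset.mul_prod_erase _ _ (Finset.mem_univ i)]
  calc cosKernel (u i) ^ m * ∏ i ∈ Finset.univ.erase i, cosKernel (u i) ^ m
      ≤ cosKernel (u i) ^ m :=
        mul_le_of_le_one_right (pow_nonneg (cosKernel_nonneg _) _) (prod_cosKernel_pow_le_one _ _ _)
    _ ≤ cosKernel ε ^ m :=
        pow_le_pow_left₀ (cosKernel_nonneg _) (cosKernel_le_of_le_norm hε hi) _

lemma prod_cosKernel_pow_eq_sum [DecidableEq ι] (m : ℕ) (u : ι → ℝ) :
    ((∏ i, cosKernel (u i) ^ m : ℝ) : ℂ) =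
      ∑ p ∈ Fintype.piFinset fun _ : ι => Finset.range (2 * m + 1),
        (((∏ i, ((2 * m).choose (p i) / 4 ^ m : ℝ) : ℝ)) : ℂ) *
          Complex.exp (2 * Real.pi * Complex.I * ∑ i, ((p i : ℤ) - m : ℤ) * (u i : ℂ)) := by
  rw [Complex.ofReal_prod]
  simp only [cosKernel_pow_eq_sum]
  rw [Finset.prod_univ_sum]
  refine Finset.sum_congr rfl fun p _ => ?_
  rw [Finset.prod_mul_distrib, ← Complex.exp_sum, ← Finset.mul_sum, Complex.ofReal_prod]

lemma sum_prod_cosKernel_pow [DecidableEq ι] {r : ℕ} (hr : 0 < r) (m : ℕ) (a : ι → ℤ) (h : ι → ℝ)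
    (hah : ∀ w : ι → ℤ, (∀ i, |w i| ≤ m) → (r : ℤ) ∣ ∑ i, w i * a i → ∑ i, w i * h i = 0) :
    ∑ j ∈ Finset.range r, ∏ i, cosKernel (j * a i / r - h i) ^ m =
      ∑ p ∈ Fintype.piFinset fun _ : ι => Finset.range (2 * m + 1),
        (∏ i, ((2 * m).choose (p i) / 4 ^ m : ℝ)) *
          (if (r : ℤ) ∣ ∑ i, ((p i : ℤ) - m) * a i then (r : ℝ) else 0) := by
  have hrC : (r : ℂ) ≠ 0 := by exact_mod_cast hr.ne'
  apply Complex.ofReal_injective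
  rw [Complex.ofReal_sum, Complex.ofReal_sum]
  simp only [prod_cosKernel_pow_eq_sum, Complex.ofReal_mul]
  rw [Finset.sum_comm]
  refine Finset.sum_congr rfl fun p hp => ?_
  rw [← Finset.mul_sum]
  congr 1
  have hsplit (j : ℕ) : Complex.exp (2 * Real.pi * Complex.I *
        ∑ i, ((p i : ℤ) - m : ℤ) * ((j * a i / r - h i : ℝ) : ℂ)) =
      Complex.exp (2 * Real.pi * Complex.I * (j * ((∑ i, ((p i : ℤ) - m) * a i : ℤ) / r))) *
        Complex.exp (2 * Real.pi * Complex.I * -((∑ i, ((p i : ℤ) - m : ℤ) * h i : ℝ) : ℂ)) := by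
    rw [← Complex.exp_add, ← mul_add]
    congr 2
    push_cast
    rw [Finset.sum_div, Finset.mul_sum, ← Finset.sum_neg_distrib, ← Finset.sum_add_distrib]
    exact Finset.sum_congr rfl fun i _ => by field_simp; ring
  simp only [hsplit]
  rw [← Finset.sum_mul, sum_exp_eq_ite hr]
  split_ifs with hd
  · have hm (i) : |(p i : ℤ) - m| ≤ m := by
      have := Finset.mem_range.1 (Fintype.mem_piFinset.1 hp i)
      rw [abs_le]; omega
    rw [hah (fun i => (p i : ℤ) - m) hm hd]
    simp
  · simp

lemma le_sum_prod_cosKernel_pow {r : ℕ} (hr : 0 < r) (m : ℕ) (a : ι → ℤ) (h : ι → ℝ)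
    (hah : ∀ w : ι → ℤ, (∀ i, |w i| ≤ m) → (r : ℤ) ∣ ∑ i, w i * a i → ∑ i, w i * h i = 0) :
    r * ((m.centralBinom : ℝ) / 4 ^ m) ^ Fintype.card ι ≤
      ∑ j ∈ Finset.range r, ∏ i, cosKernel (j * a i / r - h i) ^ m := by
  classical
  rw [sum_prod_cosKernel_pow hr m a h hah]
  have hmem : (fun _ => m) ∈ Fintype.piFinset fun _ : ι => Finset.range (2 * m + 1) := by
    simp only [Fintype.mem_piFinset, Finset.mem_range]; omega
  refine le_trans (le_of_eq ?_)
    (Finset.single_le_sum (fun p _ => by split_ifs <;> positivity) hmem)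
  simp only [sub_self, zero_mul, Finset.sum_const_zero, dvd_zero, if_true, Finset.prod_const,
    Finset.card_univ, Nat.centralBinom]
  ring

lemma mul_sub_le_card_near {r : ℕ} (hr : 0 < r) (m : ℕ) (a : ι → ℤ) (h : ι → ℝ)
    (hah : ∀ w : ι → ℤ, (∀ i, |w i| ≤ m) → (r : ℤ) ∣ ∑ i, w i * a i → ∑ i, w i * h i = 0)
    {ε : ℝ} (hε : 0 < ε) :
    r * (((m.centralBinom : ℝ) / 4 ^ m) ^ Fintype.card ι - cosKernel ε ^ m) ≤
      ((Finset.range r).filter fun j : ℕ =>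
        ∀ i, ‖((j * a i / r - h i : ℝ) : UnitAddCircle)‖ < ε).card := by
  set A := (Finset.range r).filter fun j : ℕ =>
    ∀ i, ‖((j * a i / r - h i : ℝ) : UnitAddCircle)‖ < ε
  have hterm : ∀ j ∈ Finset.range r, ∏ i, cosKernel (j * a i / r - h i) ^ m ≤
      (if j ∈ A then 1 else 0) + cosKernel ε ^ m := by
    intro j hj
    split_ifs with hjA
    · exact (prod_cosKernel_pow_le_one _ _ _).trans
        (le_add_of_nonneg_right (pow_nonneg (cosKernel_nonneg _) _))
    · obtain ⟨i, hi⟩ : ∃ i, ε ≤ ‖((j * a i / r - h i : ℝ) : UnitAddCircle)‖ := by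
        by_contra! hcon
        exact hjA (Finset.mem_filter.2 ⟨hj, hcon⟩)
      rw [zero_add]
      exact prod_cosKernel_pow_le_pow m hε hi
  have hsum := Finset.sum_le_sum hterm
  rw [Finset.sum_add_distrib, Finset.sum_ite_mem, Finset.sum_const, Finset.sum_const,
    Finset.inter_eq_right.2 (Finset.filter_subset _ _), Finset.card_range, nsmul_eq_mul,
    nsmul_eq_mul, mul_one] at hsum
  have := le_sum_prod_cosKernel_pow hr m a h hah
  rw [mul_sub]
  linarith

lemma exists_pow_lt_centralBinom_div_pow {ρ : ℝ} (h0 : 0 ≤ ρ) (h1 : ρ < 1) (d : ℕ) :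
    ∃ m : ℕ, ρ ^ m < ((m.centralBinom : ℝ) / 4 ^ m) ^ d := by
  have htend : Tendsto (fun n : ℕ => (2 ^ d : ℝ) * ((n : ℝ) ^ d * ρ ^ n)) atTop (𝓝 0) := by
    simpa using (tendsto_pow_const_mul_const_pow_of_lt_one d h0 h1).const_mul (2 ^ d : ℝ)
  obtain ⟨m, hm, hm0⟩ :=
    ((htend.eventually (gt_mem_nhds one_pos)).and (eventually_gt_atTop 0)).exists
  have : (0 : ℝ) < m := by exact_mod_cast hm0
  have h4 : (4 : ℝ) ^ m ≤ 2 * m * (m.centralBinom : ℝ) := by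
    exact_mod_cast Nat.four_pow_le_two_mul_self_mul_centralBinom m hm0
  refine ⟨m, ?_⟩
  calc ρ ^ m < (1 / (2 * m)) ^ d := by
        rw [div_pow, one_pow, lt_div_iff₀ (by positivity), mul_pow]
        linarith
    _ ≤ ((m.centralBinom : ℝ) / 4 ^ m) ^ d := by
        refine pow_le_pow_left₀ (by positivity) ?_ _
        rw [div_le_div_iff₀ (by positivity) (by positivity)]
        linarith

lemma eventually_forall_dvd_imp {U : Ultrafilter α} {r : α → ℕ} {a : α → ι → ℤ} {h : ι → ℝ}
    (hah : ∀ w : ι → ℤ, (∀ᶠ x in U, (r x : ℤ) ∣ ∑ i, w i * a x i) → ∑ i, w i * h i = 0) (m : ℕ) :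
    ∀ᶠ x in U, ∀ w : ι → ℤ, (∀ i, |w i| ≤ m) →
      (r x : ℤ) ∣ ∑ i, w i * a x i → ∑ i, w i * h i = 0 := by
  have hfin : {w : ι → ℤ | ∀ i, |w i| ≤ m}.Finite := by
    simpa only [abs_le, Set.mem_Icc] using Set.Finite.pi' fun _ : ι => Set.finite_Icc (-(m : ℤ)) m
  refine (Filter.eventually_all_finite hfin).2 fun w _ => ?_
  by_cases hw : ∀ᶠ x in U, (r x : ℤ) ∣ ∑ i, w i * a x i
  · exact Eventually.of_forall fun _ _ => hah w hw
  · filter_upwards [Ultrafilter.eventually_not.2 hw] with x hx hx' using absurd hx' hx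

/-- Kronecker's theorem for a family of finite cyclic subgroups of the torus. -/
theorem eventually_le_card_near {U : Ultrafilter α} {r : α → ℕ} (hr : Tendsto r U atTop)
    {a : α → ι → ℤ} {h : ι → ℝ}
    (hah : ∀ w : ι → ℤ, (∀ᶠ x in U, (r x : ℤ) ∣ ∑ i, w i * a x i) → ∑ i, w i * h i = 0)
    {ε : ℝ} (hε : 0 < ε) (K : ℕ) :
    ∀ᶠ x in U, K ≤ ((Finset.range (r x)).filter fun j : ℕ =>
      ∀ i, ‖((j * a x i / r x - h i : ℝ) : UnitAddCircle)‖ < ε).card := by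
  wlog hε2 : ε ≤ 1 / 2 generalizing ε
  · filter_upwards [this (ε := 1 / 2) (by norm_num) le_rfl] with x hx
    refine hx.trans (Finset.card_le_card (Finset.monotone_filter_right _ fun j _ hj i => ?_))
    exact (hj i).trans (not_le.1 hε2)
  obtain ⟨m, hm⟩ := exists_pow_lt_centralBinom_div_pow (cosKernel_nonneg ε)
    (cosKernel_lt_one hε hε2) (Fintype.card ι)
  have htend := (tendsto_natCast_atTop_atTop.comp hr).atTop_mul_const (sub_pos.2 hm)
  filter_upwards [eventually_forall_dvd_imp hah m, htend.eventually_ge_atTop (K : ℝ),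
    hr.eventually_gt_atTop 0] with x hx hKx h0x
  exact_mod_cast hKx.trans (mul_sub_le_card_near h0x m (a x) h hx hε)

end Kronecker

section GenericOrthogonal

variable {R : Type*} [CommRing R] [IsDomain R] [Infinite R]

lemma exists_linearMap_forall_apply_ne_zero {κ M : Type*} [Finite κ] [AddCommGroup M] [Module R M]
    [Module.Finite R M] [Module.Free R M] (v : κ → M) (hv : ∀ k, v k ≠ 0) :
    ∃ φ : M →ₗ[R] R, ∀ k, φ (v k) ≠ 0 := by
  have := Fintype.ofFinite κ
  let p : M →ₗ[R] Polynomial R := (Polynomial.degreeLT R (Module.finrank R M)).subtype ∘ₗ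
    ((Module.finBasis R M).equivFun.trans (Polynomial.degreeLTEquiv R _).symm).toLinearMap
  have hp : Function.Injective p := Subtype.val_injective.comp (LinearEquiv.injective _)
  have hprod : ∏ k, p (v k) ≠ 0 :=
    Finset.prod_ne_zero_iff.2 fun k _ => (map_ne_zero_iff p hp).2 (hv k)
  obtain ⟨t, ht⟩ : ∃ t, (∏ k, p (v k)).eval t ≠ 0 := by
    by_contra! h
    exact hprod (Polynomial.funext fun t => by rw [h, Polynomial.eval_zero])
  rw [Polynomial.eval_prod, Finset.prod_ne_zero_iff] at ht
  exact ⟨Polynomial.leval t ∘ₗ p, fun k => ht k (Finset.mem_univ k)⟩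

lemma exists_generic_orthogonal [IsPrincipalIdealRing R] {ι κ : Type*} [Fintype ι] [Finite κ]
    (Λ : Submodule R (ι → R)) (F : κ → ι → R) :
    ∃ c : ι → R, (∀ w ∈ Λ, ∑ i, w i * c i = 0) ∧
      ∀ k, ∑ i, F k i * c i = 0 → ∃ N : R, N ≠ 0 ∧ N • F k ∈ Λ := by
  classical
  let π : (ι → R) →ₗ[R] _ ⧸ Submodule.torsion R ((ι → R) ⧸ Λ) :=
    (Submodule.torsion R _).mkQ ∘ₗ Λ.mkQ
  have hπ (w : ι → R) : π w = 0 ↔ ∃ N : R, N ≠ 0 ∧ N • w ∈ Λ := by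
    simp only [π, LinearMap.comp_apply, Submodule.mkQ_apply, Submodule.Quotient.mk_eq_zero,
      Submodule.mem_torsion_iff, Subtype.exists, mem_nonZeroDivisors_iff_ne_zero, exists_prop,
      Submonoid.mk_smul, ← Submodule.Quotient.mk_smul]
  obtain ⟨φ, hφ⟩ := exists_linearMap_forall_apply_ne_zero (R := R)
    (fun k : {k // π (F k) ≠ 0} => π (F k)) fun k => k.2
  have hsum (w : ι → R) : φ (π w) = ∑ i, w i * φ (π fun j => if i = j then 1 else 0) :=
    LinearMap.pi_apply_eq_sum_univ (φ ∘ₗ π) w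
  refine ⟨fun i => φ (π fun j => if i = j then 1 else 0), fun w hw => ?_, fun k hk => (hπ _).1 ?_⟩
  · rw [← hsum, (hπ w).2 ⟨1, one_ne_zero, by rwa [one_smul]⟩, map_zero]
  · by_contra hne
    exact hφ ⟨k, hne⟩ ((hsum _).trans hk)

end GenericOrthogonal

section Relations

variable {α ι : Type*} [Fintype ι]

/-- The characters of the torus that are eventually trivial on the cyclic group generated by
`a x / r x`. -/
def relations (U : Filter α) (r : α → ℕ) (a : α → ι → ℤ) : Submodule ℤ (ι → ℤ) where
  carrier := {w | ∀ᶠ x in U, (r x : ℤ) ∣ ∑ i, w i * a x i}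
  zero_mem' := by simp
  add_mem' {v w} hv hw := by
    filter_upwards [hv, hw] with x hvx hwx
    simpa only [Pi.add_apply, add_mul, Finset.sum_add_distrib] using dvd_add hvx hwx
  smul_mem' m v hv := by
    filter_upwards [hv] with x hvx
    simpa only [Pi.smul_apply, smul_eq_mul, mul_assoc, ← Finset.mul_sum] using hvx.mul_left m

lemma mem_relations {U : Filter α} {r : α → ℕ} {a : α → ι → ℤ} {w : ι → ℤ} :
    w ∈ relations U r a ↔ ∀ᶠ x in U, (r x : ℤ) ∣ ∑ i, w i * a x i := Iff.rfl

/-- The vector `c` spans a line on which all eventual relations vanish, and the coordinates that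
vanish on this line are, up to the factor `N`, themselves eventual relations. -/
structure IsLimitLine (U : Filter α) (r : α → ℕ) (a : α → ι → ℤ) (c : ι → ℤ) (N : ℕ) :
    Prop where
  pos : 0 < N
  sum_mul_eq_zero : ∀ w ∈ relations U r a, ∑ i, w i * c i = 0
  eventually_dvd : ∀ᶠ x in U, ∀ i, c i = 0 → (r x : ℤ) ∣ N * a x i

lemma IsLimitLine.sum_mul_eq_zero_of_eventually_dvd {U : Filter α} {r : α → ℕ} {a : α → ι → ℤ}
    {c : ι → ℤ} {N : ℕ} (hc : IsLimitLine U r a c N) {w : ι → ℤ}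
    (hw : ∀ᶠ x in U, (r x : ℤ) ∣ N * ∑ i, w i * a x i) : ∑ i, w i * c i = 0 := by
  have hmem : (N : ℤ) • w ∈ relations U r a := mem_relations.2 <| hw.mono fun x hx => by
    simpa only [Pi.smul_apply, smul_eq_mul, mul_assoc, ← Finset.mul_sum] using hx
  have hsum := hc.sum_mul_eq_zero _ hmem
  simp only [Pi.smul_apply, smul_eq_mul, mul_assoc, ← Finset.mul_sum] at hsum
  exact (mul_eq_zero.1 hsum).resolve_left (Int.natCast_ne_zero.2 hc.pos.ne')

end Relations

section Approximation

lemma card_filter_mul_mod_le {r N : ℕ} (hN : 0 < N) {A : Finset ℕ} (hA : A ⊆ Finset.range r)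
    (d : ℕ) : (A.filter fun j => N * j % r = d).card ≤ N := by
  refine (Finset.card_le_card_of_injOn (t := Finset.range N) (fun j => N * j / r)
    (fun j hj => ?_) fun j hj j' hj' h => ?_).trans_eq (Finset.card_range N)
  · have hjr := Finset.mem_range.1 (hA (Finset.mem_filter.1 hj).1)
    exact Finset.mem_coe.2 (Finset.mem_range.2
      ((Nat.div_lt_iff_lt_mul (by omega)).2 (Nat.mul_lt_mul_of_pos_left hjr hN)))
  · have hmod : N * j % r = N * j' % r :=
      (Finset.mem_filter.1 hj).2.trans (Finset.mem_filter.1 hj').2.symm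
    exact Nat.eq_of_mul_eq_mul_left hN (by
      rw [← Nat.div_add_mod (N * j) r, ← Nat.div_add_mod (N * j') r, hmod]; simp_all)

lemma exists_mul_mod_notMem {r N : ℕ} (hN : 0 < N) {A B : Finset ℕ} (hA : A ⊆ Finset.range r)
    (hcard : N * B.card < A.card) : ∃ j ∈ A, N * j % r ∉ B := by
  by_contra! h
  exact hcard.not_ge
    (Finset.card_le_mul_card_image_of_maps_to h N fun d _ => card_filter_mul_mod_le hN hA d)

lemma coe_mul_mod_mul_div {r : ℕ} (hr : 0 < r) (m : ℕ) (z : ℤ) (y : ℝ) :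
    (((m % r : ℕ) * z / r - y : ℝ) : UnitAddCircle) = ((m * z / r - y : ℝ) : UnitAddCircle) := by
  rw [← sub_eq_zero, ← AddCircle.coe_sub, AddCircle.coe_eq_zero_iff]
  have hmod : (m : ℝ) = r * (m / r : ℕ) + (m % r : ℕ) := by
    exact_mod_cast (Nat.div_add_mod m r).symm
  refine ⟨-(((m / r : ℕ) : ℤ) * z), ?_⟩
  rw [hmod]
  simp only [Int.cast_neg, Int.cast_mul, Int.cast_natCast, zsmul_eq_mul, mul_one]
  field_simp
  ring

variable {α ι : Type*} [Fintype ι] {r : α → ℕ} {a : α → ι → ℤ} {c : ι → ℤ} {N : ℕ}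

lemma IsLimitLine.eventually_exists_near {U : Ultrafilter α} (hc : IsLimitLine U r a c N)
    (hr : Tendsto r U atTop) {k : ℕ} {J : α → Finset ℕ} (hJ : ∀ x, (J x).card ≤ k) (s : ℝ)
    {δ : ℝ} (hδ : 0 < δ) :
    ∀ᶠ x in U, ∃ j : ℕ, (0 < j ∧ j < r x ∧ j ∉ J x ∧ ∀ i, c i = 0 → (r x : ℤ) ∣ j * a x i) ∧
      ∀ i, ‖((j * a x i / r x - s * c i : ℝ) : UnitAddCircle)‖ < δ := by
  classical
  have hrel (w : ι → ℤ) (hw : ∀ᶠ x in U, (r x : ℤ) ∣ ∑ i, w i * (N * a x i)) :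
      ∑ i, w i * (s * c i) = 0 := by
    have hwc : ∑ i, w i * c i = 0 := hc.sum_mul_eq_zero_of_eventually_dvd <| hw.mono fun x hx => by
      simpa only [Finset.mul_sum, mul_left_comm] using hx
    simp only [mul_left_comm _ s, ← Finset.mul_sum]
    rw [show ∑ i, (w i : ℝ) * c i = 0 by exact_mod_cast hwc, mul_zero]
  filter_upwards [eventually_le_card_near hr hrel hδ (N * (k + 1) + 1), hc.eventually_dvd,
    hr.eventually_gt_atTop 0] with x hcard hdvd hrx
  obtain ⟨j, hj, hnot⟩ := exists_mul_mod_notMem hc.pos (B := insert 0 (J x))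
    (Finset.filter_subset _ _) (lt_of_lt_of_le (Nat.lt_succ_of_le (Nat.mul_le_mul_left N
      ((Finset.card_insert_le 0 _).trans (Nat.succ_le_succ (hJ x))))) hcard)
  rw [Finset.mem_insert, not_or] at hnot
  refine ⟨N * j % r x, ⟨Nat.pos_of_ne_zero hnot.1, Nat.mod_lt _ hrx, hnot.2, fun i hi => ?_⟩,
    fun i => ?_⟩
  · have hNj : (r x : ℤ) ∣ (N * j : ℕ) * a x i := by
      simpa only [Nat.cast_mul, mul_right_comm] using (hdvd i hi).mul_right (j : ℤ)
    rw [Int.natCast_mod]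
    exact Int.modEq_zero_iff_dvd.1
      (((Int.mod_modEq _ _).mul_right _).trans (Int.modEq_zero_iff_dvd.2 hNj))
  · rw [coe_mul_mod_mul_div hrx]
    have := (Finset.mem_filter.1 hj).2 i
    convert this using 5
    push_cast; ring

end Approximation

section Limit

lemma exists_tendsto_zero_of_eventually_exists_lt {α β : Type*} [Nonempty β] {F : Filter α}
    {P : α → β → Prop} {M : α → β → ℝ} (hfin : ∀ x, {y | P x y}.Finite) (hM : ∀ x y, 0 ≤ M x y)
    (h : ∀ δ > 0, ∀ᶠ x in F, ∃ y, P x y ∧ M x y < δ) :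
    ∃ y : α → β, (∀ᶠ x in F, P x (y x)) ∧ Tendsto (fun x => M x (y x)) F (𝓝 0) := by
  have hmin (x : α) : ∃ y, (∃ y', P x y') → P x y ∧ ∀ y', P x y' → M x y ≤ M x y' := by
    by_cases hx : ∃ y', P x y'
    · obtain ⟨y, hy, hle⟩ := Set.exists_min_image _ (M x) (hfin x) hx
      exact ⟨y, fun _ => ⟨hy, hle⟩⟩
    · exact ⟨Classical.arbitrary β, fun h => absurd h hx⟩
  choose y hy using hmin
  refine ⟨y, (h 1 one_pos).mono fun x ⟨y', hy', _⟩ => (hy x ⟨y', hy'⟩).1,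
    tendsto_order.2 ⟨fun δ hδ => Eventually.of_forall fun x => hδ.trans_le (hM _ _),
      fun δ hδ => (h δ hδ).mono fun x ⟨y', hy', hlt⟩ => ((hy x ⟨y', hy'⟩).2 y' hy').trans_lt hlt⟩⟩

lemma tendsto_fract_of_tendsto_coe {α : Type*} {F : Filter α} {u : α → ℝ} {h : ℝ}
    (hh : Int.fract h ≠ 0)
    (hu : Tendsto (fun x => (u x : UnitAddCircle)) F (𝓝 (h : UnitAddCircle))) :
    Tendsto (fun x => Int.fract (u x)) F (𝓝 (Int.fract h)) := by
  have hfract (y : ℝ) : ((AddCircle.equivIco (1 : ℝ) 0 y : Set.Ico (0 : ℝ) (0 + 1)) : ℝ) =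
      Int.fract y := by
    rw [AddCircle.coe_equivIco_mk_apply]; simp
  have hne : (h : UnitAddCircle) ≠ ((0 : ℝ) : UnitAddCircle) := fun h0 => hh (by
    rw [← hfract, h0, hfract, Int.fract_zero])
  have := (continuous_subtype_val.continuousAt.comp
    (AddCircle.continuousAt_equivIco (1 : ℝ) 0 hne)).tendsto.comp hu
  simpa only [Function.comp_def, hfract] using this

lemma fract_mul_intCast_ne_zero {s : ℝ} (hs : Irrational s) {z : ℤ} (hz : z ≠ 0) :
    Int.fract (s * z) ≠ 0 := fun h =>
  (hs.mul_intCast hz).ne_int _ (sub_eq_zero.1 ((Int.self_sub_floor _).trans h))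

lemma tendsto_fract_mul_div {α : Type*} {F : Filter α} {r : α → ℕ} (hr : ∀ x, 0 < r x)
    {a : α → ℤ} {j : α → ℕ} {s : ℝ} (hs : Irrational s) {c : ℤ}
    (hdvd : ∀ᶠ x in F, c = 0 → (r x : ℤ) ∣ j x * a x)
    (hlim : Tendsto (fun x => ((j x * a x / r x : ℝ) : UnitAddCircle)) F (𝓝 ((s * c : ℝ)))) :
    Tendsto (fun x => Int.fract (j x * a x / r x : ℝ)) F (𝓝 (Int.fract (s * c))) := by
  by_cases hc : c = 0
  · rw [hc, Int.cast_zero, mul_zero, Int.fract_zero]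
    refine tendsto_const_nhds.congr' (hdvd.mono fun x hx => ?_)
    obtain ⟨q, hq⟩ := hx hc
    have hrx : (r x : ℝ) ≠ 0 := Nat.cast_ne_zero.2 (hr x).ne'
    have hqR : (j x : ℝ) * a x = r x * q := by exact_mod_cast hq
    beta_reduce
    rw [hqR, mul_div_cancel_left₀ _ hrx, Int.fract_intCast]
  · exact tendsto_fract_of_tendsto_coe (fract_mul_intCast_ne_zero hs hc) hlim

variable {α ι : Type*} [Fintype ι] {r : α → ℕ} {a : α → ι → ℤ} {c : ι → ℤ} {N : ℕ}

lemma IsLimitLine.exists_tendsto {U : Ultrafilter α} (hc : IsLimitLine U r a c N)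
    (hr : Tendsto r U atTop) {k : ℕ} {J : α → Finset ℕ} (hJ : ∀ x, (J x).card ≤ k) (s : ℝ) :
    ∃ j : α → ℕ,
      (∀ᶠ x in U, 0 < j x ∧ j x < r x ∧ j x ∉ J x ∧ ∀ i, c i = 0 → (r x : ℤ) ∣ j x * a x i) ∧
      ∀ i, Tendsto (fun x => ((j x * a x i / r x : ℝ) : UnitAddCircle)) U (𝓝 ((s * c i : ℝ))) := by
  obtain ⟨j, hj, hlim⟩ := exists_tendsto_zero_of_eventually_exists_lt (F := U)
    (P := fun x j => 0 < j ∧ j < r x ∧ j ∉ J x ∧ ∀ i, c i = 0 → (r x : ℤ) ∣ j * a x i)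
    (M := fun x (j : ℕ) => ‖fun i => ((j * a x i / r x - s * c i : ℝ) : UnitAddCircle)‖)
    (fun x => (Set.finite_Iio (r x)).subset fun j hj => hj.2.1) (fun _ _ => norm_nonneg _)
    fun δ hδ => by
      simpa only [pi_norm_lt_iff hδ] using hc.eventually_exists_near hr hJ s hδ
  refine ⟨j, hj, fun i => tendsto_iff_norm_sub_tendsto_zero.2 <|
    squeeze_zero (fun x => norm_nonneg _) (fun x => ?_) hlim⟩
  rw [← AddCircle.coe_sub]
  exact norm_le_pi_norm (fun i => ((j x * a x i / r x - s * c i : ℝ) : UnitAddCircle)) i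

lemma exists_eventually_eq_of_sum_mul_le {U : Ultrafilter α} {v : α → ι → ℝ} {w : ι → ℝ}
    {n : α → ι → ℕ} {B : ℝ} (hv₀ : ∀ x i, 0 ≤ v x i)
    (hv : ∀ i, Tendsto (fun x => v x i) U (𝓝 (w i)))
    (hle : ∀ᶠ x in U, ∑ i, n x i * v x i ≤ B) :
    ∃ m : ι → ℕ, ∀ᶠ x in U, ∀ i, m i = if w i = 0 then 0 else n x i := by
  have hbound (i : ι) : ∃ K : ℕ, ∀ᶠ x in U, (if w i = 0 then 0 else n x i) ≤ K := by
    by_cases hi : w i = 0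
    · exact ⟨0, by simp [hi]⟩
    have hpos : 0 < w i := (ge_of_tendsto (hv i) (Eventually.of_forall fun x => hv₀ x i)).lt_of_ne'
      hi
    refine ⟨⌊B / (w i / 2)⌋₊, ?_⟩
    filter_upwards [(hv i).eventually_const_lt (half_lt_self hpos), hle] with x hx hlex
    rw [if_neg hi]
    refine Nat.le_floor ((le_div_iff₀ (half_pos hpos)).2 ?_)
    calc (n x i : ℝ) * (w i / 2) ≤ n x i * v x i := by gcongr
      _ ≤ ∑ i, n x i * v x i := Finset.single_le_sum (f := fun i => n x i * v x i)
          (fun i _ => mul_nonneg (Nat.cast_nonneg _) (hv₀ x i)) (Finset.mem_univ i)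
      _ ≤ B := hlex
  choose K hK using hbound
  have hmem : ∀ᶠ x in U, ∃ m ∈ Set.Icc 0 K, m = fun i => if w i = 0 then 0 else n x i :=
    (eventually_all.2 hK).mono fun x hx => ⟨_, ⟨fun _ => Nat.zero_le _, hx⟩, rfl⟩
  classical
  obtain ⟨m, -, hm⟩ := (Ultrafilter.eventually_exists_mem_iff (Set.finite_Icc 0 K)).1 hmem
  exact ⟨m, hm.mono fun x hx i => congrFun hx i⟩

lemma coe_div_eq_sum_zsmul {r : ℕ} (hr : 0 < r) {a w : ι → ℤ}
    (hw : (r : ℤ) ∣ ∑ i, w i * a i - 1) (j : ℕ) :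
    ((j / r : ℝ) : UnitAddCircle) = ∑ i, w i • ((j * a i / r : ℝ) : UnitAddCircle) := by
  obtain ⟨q, hq⟩ := hw
  have hrR : (r : ℝ) ≠ 0 := Nat.cast_ne_zero.2 hr.ne'
  have hqR : ∑ i, (w i : ℝ) * a i = 1 + r * q := by
    rw [← sub_eq_iff_eq_add']; exact_mod_cast hq
  have hsum : ∑ i, w i • (j * a i / r : ℝ) = j / r + (j * q : ℤ) := by
    calc ∑ i, w i • (j * a i / r : ℝ) = j / r * ∑ i, (w i : ℝ) * a i := by
          rw [Finset.mul_sum]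
          exact Finset.sum_congr rfl fun i _ => by rw [zsmul_eq_mul]; ring
      _ = j / r + (j * q : ℤ) := by rw [hqR]; push_cast; field_simp
  simp_rw [← AddCircle.coe_zsmul]
  rw [← QuotientAddGroup.mk_sum, hsum, AddCircle.coe_add, left_eq_add, AddCircle.coe_eq_zero_iff]
  exact ⟨j * q, by rw [zsmul_eq_mul, mul_one]⟩

lemma tendsto_div_of_dvd_sum_sub_one {F : Filter α} (hr : ∀ x, 0 < r x) {w : ι → ℤ}
    (hw : ∀ x, (r x : ℤ) ∣ ∑ i, w i * a x i - 1) (hwc : ∑ i, w i * c i ≠ 0) {j : α → ℕ} {s : ℝ}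
    (hs : Irrational s) (hj : ∀ᶠ x in F, j x < r x)
    (hlim : ∀ i, Tendsto (fun x => ((j x * a x i / r x : ℝ) : UnitAddCircle)) F
      (𝓝 ((s * c i : ℝ)))) :
    Tendsto (fun x => (j x / r x : ℝ)) F (𝓝 (Int.fract (s * (∑ i, w i * c i : ℤ)))) := by
  have hcoe : ((s * (∑ i, w i * c i : ℤ) : ℝ) : UnitAddCircle) =
      ∑ i, w i • ((s * c i : ℝ) : UnitAddCircle) := by
    simp_rw [← AddCircle.coe_zsmul]
    rw [← QuotientAddGroup.mk_sum]
    push_cast [zsmul_eq_mul, Finset.mul_sum]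
    exact congrArg _ (Finset.sum_congr rfl fun i _ => by ring)
  have htendsto : Tendsto (fun x => ((j x / r x : ℝ) : UnitAddCircle)) F
      (𝓝 ((s * (∑ i, w i * c i : ℤ) : ℝ))) := by
    simp_rw [coe_div_eq_sum_zsmul (hr _) (hw _)]
    rw [hcoe]
    exact tendsto_finsetSum _ fun i _ => (hlim i).const_smul _
  refine (tendsto_fract_of_tendsto_coe (fract_mul_intCast_ne_zero hs hwc) htendsto).congr'
    (hj.mono fun x hx => ?_)
  have hrx : (0 : ℝ) < r x := Nat.cast_pos.2 (hr x)
  exact Int.fract_eq_self.2 ⟨by positivity, (div_lt_one hrx).2 (Nat.cast_lt.2 hx)⟩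

variable {U : Ultrafilter α} {k : ℕ} {ε : ι → ℤ} {S : α → Set (ι → ℕ)}

lemma sum_mul_eq_of_eventually_mem (hadm : ∀ x, Admissible k (r x) (a x) ε (S x))
    (hc : IsLimitLine U r a c N) {m : ι → ℕ}
    (hm : ∀ᶠ x in U, ∃ n ∈ S x, ∀ i, c i ≠ 0 → n i = m i) :
    ∑ i, (m i : ℤ) * c i = ∑ i, ε i * c i := by
  rw [← sub_eq_zero, ← Finset.sum_sub_distrib]
  simp_rw [← sub_mul]
  refine hc.sum_mul_eq_zero_of_eventually_dvd ?_
  filter_upwards [hm, hc.eventually_dvd] with x ⟨n, hn, hnm⟩ hdvd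
  have hsplit : N * ∑ i, ((m i : ℤ) - ε i) * a x i =
      N * ∑ i, ((n i : ℤ) - ε i) * a x i + ∑ i, ((m i : ℤ) - n i) * (N * a x i) := by
    simp_rw [Finset.mul_sum]
    rw [← Finset.sum_add_distrib]
    exact Finset.sum_congr rfl fun i _ => by ring
  rw [hsplit]
  refine dvd_add (((hadm x).dvd_exponent n hn).mul_left _) (Finset.dvd_sum fun i _ => ?_)
  by_cases hi : c i = 0
  · exact (hdvd i hi).mul_left _
  · rw [hnm i hi, sub_self, zero_mul]
    exact dvd_zero _

theorem exists_limit_exponent (hr : Tendsto r U atTop)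
    (hadm : ∀ x, Admissible k (r x) (a x) ε (S x)) (hc : IsLimitLine U r a c N)
    (hε : ∑ i, (1 - ε i) * c i ≠ 0) {s : ℝ} (hs : Irrational s) (b : ι → ℕ) :
    ∃ m : ι → ℕ, (∀ᶠ x in U, ∃ n ∈ S x, ∀ i, c i ≠ 0 ∨ b i ≠ 0 → n i = m i) ∧
      ∑ i, m i * (Int.fract (s * c i) + b i) + 1 + Int.fract (s * (∑ i, (1 - ε i) * c i : ℤ)) ≤
        ∑ i, (Int.fract (s * c i) + b i) := by
  choose J hJ hex using fun x => (hadm x).exists_exceptions b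
  obtain ⟨j, hj, hlim⟩ := hc.exists_tendsto hr hJ s
  have hr₀ (x : α) := (hadm x).r_pos
  set v : α → ι → ℝ := fun x i => Int.fract (j x * a x i / r x : ℝ) + b i
  set w : ι → ℝ := fun i => Int.fract (s * c i) + b i
  have hv (i : ι) : Tendsto (fun x => v x i) U (𝓝 (w i)) :=
    (tendsto_fract_mul_div hr₀ hs (hj.mono fun x hx => hx.2.2.2 i) (hlim i)).add_const _
  have hjr := tendsto_div_of_dvd_sum_sub_one hr₀ (fun x => (hadm x).dvd_sum_sub_one) hε hs
    (hj.mono fun x hx => hx.2.1) hlim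
  have hn (x : α) : ∃ n : ι → ℕ, 0 < j x ∧ j x < r x ∧ j x ∉ J x →
      n ∈ S x ∧ ∑ i, n i * v x i + 1 + (j x : ℝ) / r x ≤ ∑ i, v x i := by
    by_cases h : 0 < j x ∧ j x < r x ∧ j x ∉ J x
    · obtain ⟨n, hn⟩ := hex x (j x) h.1 h.2.1 h.2.2
      exact ⟨n, fun _ => hn⟩
    · exact ⟨0, fun h' => absurd h' h⟩
  choose n hn using hn
  replace hn := hj.mono fun x hx => hn x ⟨hx.1, hx.2.1, hx.2.2.1⟩
  have hv₀ (x : α) (i : ι) : 0 ≤ v x i := add_nonneg (Int.fract_nonneg _) (Nat.cast_nonneg _)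
  obtain ⟨m, hm⟩ := exists_eventually_eq_of_sum_mul_le (n := n) (B := ∑ i, (1 + b i : ℝ)) hv₀ hv
    (hn.mono fun x hx => by
      have hle : ∑ i, v x i ≤ ∑ i, (1 + b i : ℝ) :=
        Finset.sum_le_sum fun i _ => add_le_add_left (Int.fract_lt_one _).le _
      linarith [hx.2, show (0 : ℝ) ≤ j x / r x by positivity])
  have hw {i : ι} (hi : w i = 0) : c i = 0 ∧ b i = 0 := by
    obtain ⟨hfract, hb⟩ := (add_eq_zero_iff_of_nonneg (Int.fract_nonneg _)
      (Nat.cast_nonneg _)).1 hi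
    exact ⟨by_contra fun h => fract_mul_intCast_ne_zero hs h hfract, Nat.cast_eq_zero.1 hb⟩
  refine ⟨m, ?_, le_of_tendsto_of_tendsto
    (((tendsto_finsetSum _ fun i _ => (hv i).const_mul _).add_const 1).add hjr)
    (tendsto_finsetSum _ fun i _ => hv i) ?_⟩
  · filter_upwards [hm, hn] with x hmx hnx
    refine ⟨n x, hnx.1, fun i hi => ?_⟩
    rw [hmx, if_neg fun h => ?_]
    exact hi.elim (· (hw h).1) (· (hw h).2)
  · filter_upwards [hm, hn] with x hmx hnx
    refine le_trans ?_ hnx.2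
    gcongr with i
    rw [hmx]; split_ifs <;> simp

/-- The limit of the weight inequalities along the line spanned by `c`: for fractional parts
`{s cᵢ}` it reads `∑ᵢ nᵢ ({s cᵢ} + bᵢ) + 1 + {s t} ≤ ∑ᵢ ({s cᵢ} + bᵢ)` with
`t = ∑ᵢ (1 - εᵢ) cᵢ`, and `∑ᵢ nᵢ cᵢ = ∑ᵢ εᵢ cᵢ` turns this into an inequality of integers. -/
def LineCondition (ε : ι → ℤ) (E : Set (ι → ℕ)) (b : ι → ℕ) (c : ι → ℤ) : Prop :=
  ∀ s : ℝ, Irrational s → ∃ n ∈ E, ∑ i, n i * c i = ∑ i, ε i * c i ∧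
    ∑ i, ⌊s * c i⌋ + 1 + ∑ i, (n i : ℤ) * b i ≤
      ⌊s * (∑ i, (1 - ε i) * c i : ℤ)⌋ + ∑ i, n i * ⌊s * c i⌋ + ∑ i, (b i : ℤ)

lemma sum_floor_le_of_sum_fract_le {n b : ι → ℕ} {s : ℝ}
    (hn : ∑ i, n i * c i = ∑ i, ε i * c i)
    (h : ∑ i, n i * (Int.fract (s * c i) + b i) + 1 + Int.fract (s * (∑ i, (1 - ε i) * c i : ℤ)) ≤
      ∑ i, (Int.fract (s * c i) + b i)) :
    ∑ i, ⌊s * c i⌋ + 1 + ∑ i, (n i : ℤ) * b i ≤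
      ⌊s * (∑ i, (1 - ε i) * c i : ℤ)⌋ + ∑ i, n i * ⌊s * c i⌋ + ∑ i, (b i : ℤ) := by
  have hnR : ∑ i, (n i : ℝ) * c i = ∑ i, (ε i : ℝ) * c i := by exact_mod_cast hn
  have ht : ((∑ i, (1 - ε i) * c i : ℤ) : ℝ) = ∑ i, (c i : ℝ) - ∑ i, (ε i : ℝ) * c i := by
    push_cast
    simp only [sub_mul, one_mul, Finset.sum_sub_distrib]
  suffices ((∑ i, ⌊s * c i⌋ + 1 + ∑ i, (n i : ℤ) * b i : ℤ) : ℝ) ≤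
      (⌊s * (∑ i, (1 - ε i) * c i : ℤ)⌋ + ∑ i, n i * ⌊s * c i⌋ + ∑ i, (b i : ℤ) : ℤ) by
    exact_mod_cast this
  have hsplit : ∑ i, n i * (Int.fract (s * c i) + b i) =
      s * ∑ i, n i * (c i : ℝ) - ∑ i, n i * (⌊s * c i⌋ : ℝ) + ∑ i, (n i : ℝ) * b i := by
    simp only [Int.fract, Finset.mul_sum, ← Finset.sum_sub_distrib, ← Finset.sum_add_distrib]
    exact Finset.sum_congr rfl fun i _ => by ring
  rw [hsplit] at h
  generalize (∑ i, (1 - ε i) * c i : ℤ) = t at h ht ⊢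
  simp only [Int.fract, Finset.sum_add_distrib, Finset.sum_sub_distrib, ← Finset.mul_sum] at h
  rw [ht] at h
  push_cast
  rw [ht]
  linear_combination h - s * hnR

theorem IsLimitLine.lineCondition (hc : IsLimitLine U r a c N) (hr : Tendsto r U atTop)
    (hadm : ∀ x, Admissible k (r x) (a x) ε (S x)) {E : Set (ι → ℕ)} (hS : ∀ x, S x ⊆ E)
    (hε : ∑ i, (1 - ε i) * c i ≠ 0) {b : ι → ℕ} (hb : ∀ i, c i ≠ 0 ∨ b i ≠ 0) :
    LineCondition ε E b c := by
  intro s hs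
  obtain ⟨m, hm, hle⟩ := exists_limit_exponent hr hadm hc hε hs b
  have hmc := sum_mul_eq_of_eventually_mem hadm hc <| hm.mono fun x ⟨n, hn, hnm⟩ =>
    ⟨n, hn, fun i hi => hnm i (Or.inl hi)⟩
  obtain ⟨x, n, hn, hnm⟩ := hm.exists
  obtain rfl : n = m := funext fun i => hnm i (hb i)
  exact ⟨n, hS x hn, hmc, sum_floor_le_of_sum_fract_le hmc hle⟩

end Limit

section Existence

variable {α ι : Type*} [Fintype ι] {r : α → ℕ} {a : α → ι → ℤ} {U : Ultrafilter α}

lemma not_eventually_dvd {F : Filter α} [F.NeBot] (hr : Tendsto r F atTop) {m : ℕ} (hm : 0 < m) :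
    ¬ ∀ᶠ x in F, (r x : ℤ) ∣ m := fun h => by
  obtain ⟨x, hdvd, hlt⟩ := (h.and (hr.eventually_gt_atTop m)).exists
  exact hlt.not_ge (Nat.le_of_dvd hm (Int.natCast_dvd_natCast.1 hdvd))

lemma exists_isLimitLine (U : Filter α) (r : α → ℕ) (a : α → ι → ℤ) (w : ι → ℤ) :
    ∃ (c : ι → ℤ) (N : ℕ), IsLimitLine U r a c N ∧
      (∑ i, w i * c i = 0 → ∀ᶠ x in U, (r x : ℤ) ∣ N * ∑ i, w i * a x i) := by
  classical
  obtain ⟨c, hc, hgen⟩ := exists_generic_orthogonal (relations U r a)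
    (fun o : Option ι => o.elim w fun i => Pi.single i 1)
  have hN (o : Option ι) : ∃ N : ℤ, N ≠ 0 ∧
      (∑ i, o.elim w (fun i => Pi.single i 1) i * c i = 0 →
        ∀ᶠ x in U, (r x : ℤ) ∣ N * ∑ i, o.elim w (fun i => Pi.single i 1) i * a x i) := by
    by_cases ho : ∑ i, o.elim w (fun i => Pi.single i 1) i * c i = 0
    · obtain ⟨N, hN, hmem⟩ := hgen o ho
      refine ⟨N, hN, fun _ => (mem_relations.1 hmem).mono fun x hx => ?_⟩
      simpa only [Pi.smul_apply, smul_eq_mul, mul_assoc, ← Finset.mul_sum] using hx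
    · exact ⟨1, one_ne_zero, fun h => absurd h ho⟩
  choose N hN hdvd using hN
  have hprod (o : Option ι) {x : α} {z : ℤ} (h : (r x : ℤ) ∣ N o * z) :
      (r x : ℤ) ∣ (∏ o, (N o).natAbs : ℕ) * z :=
    h.trans (mul_dvd_mul_right (Int.dvd_natCast.2
      (Finset.dvd_prod_of_mem (fun o => (N o).natAbs) (Finset.mem_univ o))) _)
  refine ⟨c, ∏ o, (N o).natAbs,
    ⟨Finset.prod_pos fun o _ => Int.natAbs_pos.2 (hN o), hc, eventually_all.2 fun i => ?_⟩,
    fun h => (hdvd none h).mono fun x => hprod none⟩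
  by_cases hi : c i = 0
  · exact (hdvd (some i) (by simp [Pi.single_apply, hi])).mono fun x hx _ =>
      hprod (some i) (by simpa [Pi.single_apply] using hx)
  · exact Eventually.of_forall fun x h => absurd h hi

variable {k : ℕ} {ε : ι → ℤ} {S : α → Set (ι → ℕ)} {c : ι → ℤ} {N : ℕ}

lemma exists_isLimitLine_of_admissible (hr : Tendsto r U atTop)
    (hadm : ∀ x, Admissible k (r x) (a x) ε (S x)) :
    ∃ (c : ι → ℤ) (N : ℕ), IsLimitLine U r a c N ∧ ∑ i, (1 - ε i) * c i ≠ 0 := by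
  obtain ⟨c, N, hc, ht⟩ := exists_isLimitLine U r a fun i => 1 - ε i
  refine ⟨c, N, hc, fun h => not_eventually_dvd hr hc.pos ((ht h).mono fun x hx => ?_)⟩
  have hsub := (hadm x).dvd_sum_sub_one.mul_left N
  rwa [mul_sub, mul_one, dvd_sub_right hx] at hsub

lemma IsLimitLine.ne_zero_of_eq_zero (hc : IsLimitLine U r a c N) (hr : Tendsto r U atTop)
    (hadm : ∀ x, Admissible k (r x) (a x) ε (S x)) {i j : ι} (hij : i ≠ j) (hi : c i = 0) :
    c j ≠ 0 := fun hj =>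
  not_eventually_dvd hr hc.pos <| hc.eventually_dvd.mono fun x hx =>
    (hadm x).dvd_of_dvd_mul i j hij N (hx i hi) (hx j hj)

lemma IsLimitLine.sum_mul_eq_zero_of_eq_zero (hc : IsLimitLine U r a c N)
    (hadm : ∀ x, Admissible k (r x) (a x) ε (S x)) {i : ι} (hi : c i = 0) :
    ∑ i, ε i * c i = 0 :=
  hc.sum_mul_eq_zero_of_eventually_dvd <| hc.eventually_dvd.mono fun x hx =>
    (hadm x).dvd_mul_sum i N (hx i hi)

lemma exists_bound_of_forall_hyperfilter {β γ : Type*} {P : ℕ → β → γ → Prop}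
    (h : ∀ (r : ℕ → ℕ) (a : ℕ → β) (S : ℕ → γ),
      Tendsto r (hyperfilter ℕ) atTop → ¬ ∀ x, P (r x) (a x) (S x)) :
    ∃ R, ∀ r a S, P r a S → r ≤ R := by
  by_contra! hcon
  choose r a S hP hlt using hcon
  exact h r a S ((tendsto_atTop_mono (fun x => (hlt x).le) tendsto_id).mono_left
    Nat.hyperfilter_le_atTop) hP

end Existence

section Floor

lemma floor_neg_mul {s : ℝ} (hs : Irrational s) {c : ℤ} (hc : c ≠ 0) :
    ⌊-s * c⌋ = -⌊s * c⌋ - 1 := by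
  rw [neg_mul, Int.floor_neg, Int.ceil_eq_floor_add_one_iff_notMem _ |>.2]
  · ring
  · rintro ⟨m, hm⟩
    exact (hs.mul_intCast hc).ne_int m hm.symm

lemma floor_mul_neg {s : ℝ} (hs : Irrational s) {c : ℤ} (hc : c ≠ 0) :
    ⌊s * (-c : ℤ)⌋ = -⌊s * c⌋ - 1 := by
  rw [Int.cast_neg, mul_neg, ← neg_mul, floor_neg_mul hs hc]

lemma floor_lt_of_irrational {s : ℝ} (hs : Irrational s) {c : ℤ} (hc : c ≠ 0) :
    (⌊s * c⌋ : ℝ) < s * c :=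
  (Int.floor_le _).lt_of_ne ((hs.mul_intCast hc).ne_int _).symm

lemma exists_irrational_of_eventually {P : ℝ → Prop} (h : ∀ᶠ s in 𝓝[>] 0, P s) :
    ∃ s, Irrational s ∧ P s := by
  obtain ⟨u, hu, hP⟩ := mem_nhdsGT_iff_exists_Ioo_subset.1 h
  obtain ⟨s, hs, h0, hsu⟩ := exists_irrational_btwn (Set.mem_Ioi.1 hu)
  exact ⟨s, hs, hP ⟨h0, hsu⟩⟩

lemma eventually_floor_add_mul (x : ℝ) (z : ℤ) :
    ∀ᶠ η : ℝ in 𝓝[>] 0, ⌊(x + η) * z⌋ = if z < 0 then ⌈x * z⌉ - 1 else ⌊x * z⌋ := by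
  have hlim : Tendsto (fun η : ℝ => (x + η) * z) (𝓝[>] 0) (𝓝 (x * z)) := by
    have : ContinuousAt (fun η : ℝ => (x + η) * z) 0 := by fun_prop
    simpa using this.tendsto.mono_left nhdsWithin_le_nhds
  have hpos : ∀ᶠ η : ℝ in 𝓝[>] 0, 0 < η := eventually_mem_nhdsWithin
  split_ifs with hz
  · have hzR : (z : ℝ) < 0 := Int.cast_lt_zero.2 hz
    exact tendsto_pure.1 <| (tendsto_floor_left_pure_ceil_sub_one _).comp <|
      tendsto_nhdsWithin_iff.2 ⟨hlim, hpos.mono fun η hη => Set.mem_Iio.2 (by nlinarith)⟩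
  · have hzR : (0 : ℝ) ≤ z := Int.cast_nonneg (not_lt.1 hz)
    exact tendsto_pure.1 <| (tendsto_floor_right_pure_floor _).comp <|
      tendsto_nhdsWithin_iff.2 ⟨hlim, hpos.mono fun η hη => Set.mem_Ici.2 (by nlinarith)⟩

lemma eventually_floor_mul (z : ℤ) :
    ∀ᶠ s : ℝ in 𝓝[>] 0, ⌊s * z⌋ = if z < 0 then -1 else 0 := by
  simpa using eventually_floor_add_mul 0 z

lemma floor_add_one_sub_ceil_div {d : ℕ} (hd : 0 < d) (z : ℤ) :
    ⌊(1 / d * z : ℝ)⌋ + 1 - ⌈(1 / d * z : ℝ)⌉ = if (d : ℤ) ∣ z then 1 else 0 := by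
  have hdR : (d : ℝ) ≠ 0 := Nat.cast_ne_zero.2 hd.ne'
  split_ifs with h
  · obtain ⟨q, rfl⟩ := h
    rw [show (1 / d * ((d * q : ℤ) : ℝ) : ℝ) = q by push_cast; field_simp, Int.floor_intCast,
      Int.ceil_intCast]
    ring
  · rw [(Int.ceil_eq_floor_add_one_iff_notMem _).2, sub_self]
    rintro ⟨q, hq⟩
    refine h ⟨q, ?_⟩
    have : (z : ℝ) = d * q := by rw [hq]; field_simp
    exact_mod_cast this

lemma eventually_floor_sub_floor {d : ℕ} (hd : 0 < d) (z : ℤ) :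
    ∀ᶠ η : ℝ in 𝓝[>] 0,
      ⌊(1 / d + η) * z⌋ - ⌊(1 / d - η) * z⌋ = if (d : ℤ) ∣ z then z.sign else 0 := by
  filter_upwards [eventually_floor_add_mul (1 / d) z, eventually_floor_add_mul (-(1 / d)) (-z)]
    with η hright hleft
  have hjump := floor_add_one_sub_ceil_div hd z
  rw [show (-(1 / d) + η) * ((-z : ℤ) : ℝ) = (1 / d - η) * z by push_cast; ring,
    show -(1 / d) * ((-z : ℤ) : ℝ) = 1 / d * z by push_cast; ring] at hleft
  rcases lt_trichotomy z 0 with hz | rfl | hz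
  · rw [Int.sign_eq_neg_one_of_neg hz]
    split_ifs at * <;> omega
  · simp
  · rw [Int.sign_eq_one_of_pos hz]
    split_ifs at * <;> omega

end Floor

section Pairing

variable {ι : Type*} [Fintype ι] {z : ι → ℤ}

lemma sum_sign_dvd_eq_zero {C : ℤ} (h : ∀ s : ℝ, Irrational s → ∑ i, ⌊s * z i⌋ = C) {d : ℕ}
    (hd : 0 < d) : ∑ i with (d : ℤ) ∣ z i, (z i).sign = 0 := by
  obtain ⟨η, hη, hjump⟩ := exists_irrational_of_eventually
    (eventually_all.2 fun i => eventually_floor_sub_floor hd (z i))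
  have hadd : Irrational (1 / d + η) := by simpa using hη.ratCast_add (1 / d : ℚ)
  have hsub : Irrational (1 / d - η) := by simpa using hη.ratCast_sub (1 / d : ℚ)
  rw [Finset.sum_filter, ← Finset.sum_congr rfl fun i _ => hjump i, Finset.sum_sub_distrib,
    h _ hadd, h _ hsub, sub_self]

lemma eq_zero_of_sum_multiples_eq_zero {M : Type*} [AddCommMonoid M] {f : ℕ → M} {B : ℕ}
    (h : ∀ d, 0 < d → ∑ D ∈ Finset.Icc 1 B with d ∣ D, f D = 0) {D : ℕ} (hD : D ∈ Finset.Icc 1 B) :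
    f D = 0 := by
  induction hk : B - D using Nat.strong_induction_on generalizing D with
  | _ k ih =>
    obtain ⟨hD₁, hDB⟩ := Finset.mem_Icc.1 hD
    have hsum := h D hD₁
    rwa [Finset.sum_eq_single_of_mem D (Finset.mem_filter.2 ⟨hD, dvd_rfl⟩)] at hsum
    intro D' hD' hne
    obtain ⟨hmem, hdvd⟩ := Finset.mem_filter.1 hD'
    have hlt := (Nat.le_of_dvd (Finset.mem_Icc.1 hmem).1 hdvd).lt_of_ne' hne
    exact ih (B - D') (by have := (Finset.mem_Icc.1 hmem).2; omega) hmem rfl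

lemma sum_sign_natAbs_eq_zero {C : ℤ} (h : ∀ s : ℝ, Irrational s → ∑ i, ⌊s * z i⌋ = C) {d : ℕ}
    (hd : 0 < d) : ∑ i with (z i).natAbs = d, (z i).sign = 0 := by
  obtain ⟨B, hB⟩ : ∃ B, d ≤ B ∧ ∀ i, (z i).natAbs ≤ B :=
    ⟨d + ∑ i, (z i).natAbs, Nat.le_add_right _ _, fun i => (Finset.single_le_sum
      (f := fun i => (z i).natAbs) (fun _ _ => Nat.zero_le _) (Finset.mem_univ i)).trans
      (Nat.le_add_left _ _)⟩
  refine eq_zero_of_sum_multiples_eq_zero (f := fun D => ∑ i with (z i).natAbs = D, (z i).sign)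
    (fun d hd => ?_) (Finset.mem_Icc.2 ⟨hd, hB.1⟩)
  rw [← sum_sign_dvd_eq_zero h hd, ← Finset.sum_filter_of_ne (p := (z · ≠ 0))
    fun i _ hi => by simpa using hi, Finset.filter_filter]
  refine (Finset.sum_comm' (s' := fun i => {(z i).natAbs}) fun D i => ?_).trans
    (Finset.sum_congr rfl fun i _ => Finset.sum_singleton _ _)
  simp only [Finset.mem_filter, Finset.mem_univ, true_and, Finset.mem_Icc, Finset.mem_singleton,
    eq_comm (a := D)]
  constructor
  · rintro ⟨⟨⟨hD, -⟩, hdvd⟩, rfl⟩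
    exact ⟨rfl, Int.natCast_dvd.2 hdvd, Int.natAbs_pos.1 hD⟩
  · rintro ⟨rfl, hdvd, hi⟩
    exact ⟨⟨⟨Int.natAbs_pos.2 hi, hB.2 i⟩, Int.natCast_dvd.1 hdvd⟩, rfl⟩

lemma exists_eq_neg_of_sum_floor_eq {C : ℤ} (h : ∀ s : ℝ, Irrational s → ∑ i, ⌊s * z i⌋ = C)
    {i : ι} (hi : z i ≠ 0) : ∃ j, z j = -z i := by
  by_contra! hcon
  have hsum : ∑ j with (z j).natAbs = (z i).natAbs, (z i).sign = 0 := by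
    rw [← sum_sign_natAbs_eq_zero h (Int.natAbs_pos.2 hi)]
    refine Finset.sum_congr rfl fun j hj => ?_
    rw [(Int.natAbs_eq_natAbs_iff.1 (Finset.mem_filter.1 hj).2).resolve_right (hcon j)]
  rw [Finset.sum_const, smul_eq_zero, Finset.card_eq_zero, Int.sign_eq_zero_iff_zero] at hsum
  exact hsum.elim (Finset.ne_empty_of_mem (a := i) (by simp)) hi

/-- The substitution `s ↦ -s` turns the inequality into its reverse. -/
lemma two_mul_sum_floor_eq (hz : ∀ i, z i ≠ 0)
    (h : ∀ s : ℝ, Irrational s → 2 * ∑ i, ⌊s * z i⌋ ≤ -Fintype.card ι) {s : ℝ}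
    (hs : Irrational s) : 2 * ∑ i, ⌊s * z i⌋ = -Fintype.card ι := by
  have hneg : ∑ i, ⌊-s * z i⌋ = -∑ i, ⌊s * z i⌋ - Fintype.card ι := by
    simp only [floor_neg_mul hs (hz _), Finset.sum_sub_distrib, Finset.sum_neg_distrib,
      Finset.sum_const, Finset.card_univ, nsmul_eq_mul, mul_one]
  have := h s hs
  have := h (-s) hs.neg
  omega

lemma exists_eq_neg_of_sum_floor_le (hz : ∀ i, z i ≠ 0)
    (h : ∀ s : ℝ, Irrational s → 2 * ∑ i, ⌊s * z i⌋ ≤ -Fintype.card ι) (i : ι) :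
    ∃ j, z j = -z i :=
  exists_eq_neg_of_sum_floor_eq (C := -Fintype.card ι / 2)
    (fun s hs => by have := two_mul_sum_floor_eq hz h hs; omega) (hz i)

end Pairing

section LineCondition

variable {ι : Type*} [Fintype ι] {ε : ι → ℤ} {E : Set (ι → ℕ)} {b : ι → ℕ} {c : ι → ℤ}

lemma LineCondition.neg (h : LineCondition ε E b c) : LineCondition ε E b (-c) := by
  intro s hs
  obtain ⟨n, hn, hsum, hle⟩ := h (-s) hs.neg
  refine ⟨n, hn, ?_, ?_⟩
  · simpa only [Pi.neg_apply, mul_neg, Finset.sum_neg_distrib, neg_inj] using hsum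
  · simpa only [Pi.neg_apply, mul_neg, Finset.sum_neg_distrib, Int.cast_neg, neg_mul] using hle

lemma LineCondition.comp_perm (h : LineCondition ε E b c) (σ : Equiv.Perm ι) (hε : ε ∘ σ = ε)
    (hb : b ∘ σ = b) (hE : ∀ n ∈ E, n ∘ σ ∈ E) : LineCondition ε E b (c ∘ σ) := by
  suffices LineCondition (ε ∘ σ) E (b ∘ σ) (c ∘ σ) by rwa [hε, hb] at this
  intro s hs
  obtain ⟨n, hn, hsum, hle⟩ := h s hs
  refine ⟨n ∘ σ, hE n hn, ?_, ?_⟩ <;> simp only [Function.comp_apply]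
  · rwa [Equiv.sum_comp σ fun i => (n i : ℤ) * c i, Equiv.sum_comp σ fun i => ε i * c i]
  · rwa [Equiv.sum_comp σ fun i => ⌊s * c i⌋, Equiv.sum_comp σ fun i => (n i : ℤ) * b i,
      Equiv.sum_comp σ fun i => (1 - ε i) * c i,
      Equiv.sum_comp σ fun i => (n i : ℤ) * ⌊s * c i⌋, Equiv.sum_comp σ fun i => (b i : ℤ)]

lemma LineCondition.of_smul {g : ℤ} (hg : g ≠ 0) (h : LineCondition ε E b (g • c)) :
    LineCondition ε E b c := by
  intro s hs
  obtain ⟨n, hn, hsum, hle⟩ := h (s / g) (hs.div_intCast hg)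
  have hgR : (g : ℝ) ≠ 0 := Int.cast_ne_zero.2 hg
  have hscale (z : ℤ) : s / g * (g * z : ℤ) = s * z := by push_cast; field_simp
  simp only [Pi.smul_apply, smul_eq_mul, mul_left_comm _ g, ← Finset.mul_sum, hscale] at hsum hle
  exact ⟨n, hn, mul_left_cancel₀ hg hsum, hle⟩

lemma comp_mem_tailExponents {s : Set ι} {d : ℕ} (σ : Equiv.Perm ι) (hσ : ∀ i, σ i ∈ s → i ∈ s)
    {n : ι → ℕ} (hn : n ∈ tailExponents s d) : n ∘ σ ∈ tailExponents s d :=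
  ⟨fun i hi => hn.1 _ (mt (hσ i) hi), hn.2.trans_eq (Equiv.sum_comp σ n).symm⟩

lemma sum_mul_floor_le (n : ι → ℕ) (c : ι → ℤ) (s : ℝ) :
    ∑ i, (n i : ℤ) * ⌊s * c i⌋ ≤ ⌊s * (∑ i, (n i : ℤ) * c i : ℤ)⌋ := by
  rw [Int.le_floor]
  push_cast
  rw [Finset.mul_sum]
  exact Finset.sum_le_sum fun i _ => by
    rw [mul_left_comm]
    gcongr
    exact Int.floor_le _

lemma sum_mul_floor_neg {n : ι → ℕ} {c : ι → ℤ} {s : ℝ} (hs : Irrational s)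
    (hn : ∑ i, (n i : ℤ) * c i = 0) {i : ι} (hi : n i ≠ 0) (hci : c i ≠ 0) :
    ∑ i, (n i : ℤ) * ⌊s * c i⌋ < 0 := by
  suffices ∑ i, (n i : ℝ) * ⌊s * c i⌋ < 0 by exact_mod_cast this
  calc ∑ i, (n i : ℝ) * ⌊s * c i⌋ < ∑ i, (n i : ℝ) * (s * c i) := by
        refine Finset.sum_lt_sum (fun j _ => by gcongr; exact Int.floor_le _)
          ⟨i, Finset.mem_univ i, ?_⟩
        exact mul_lt_mul_of_pos_left (floor_lt_of_irrational hs hci)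
          (Nat.cast_pos.2 (Nat.pos_of_ne_zero hi))
    _ = s * (∑ i, (n i : ℤ) * c i : ℤ) := by
        push_cast
        rw [Finset.mul_sum]
        exact Finset.sum_congr rfl fun i _ => by ring
    _ = 0 := by rw [hn, Int.cast_zero, mul_zero]

lemma LineCondition.sum_floor_le (h : LineCondition ε E 0 c) {s : ℝ} (hs : Irrational s) :
    ∑ i, ⌊s * c i⌋ + 1 ≤
      ⌊s * (∑ i, (1 - ε i) * c i : ℤ)⌋ + ⌊s * (∑ i, ε i * c i : ℤ)⌋ := by
  obtain ⟨n, -, hsum, hle⟩ := h s hs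
  have := sum_mul_floor_le n c s
  rw [hsum] at this
  simp only [Pi.zero_apply, Nat.cast_zero, mul_zero, Finset.sum_const_zero, add_zero] at hle
  omega

end LineCondition

section FourVariables

variable {ε : Fin 4 → ℤ} {E : Set (Fin 4 → ℕ)} {c : Fin 4 → ℤ} {e t : ℤ}

/-- The weights `c` of the four variables along a line, and the negatives of the weights `e` of the
equation and `t` of the generator `x₁x₂x₃x₄ / f`; these six numbers will turn out to cancel in
pairs. -/
def lineWeights (c : Fin 4 → ℤ) (e t : ℤ) : Fin 4 ⊕ Fin 2 → ℤ :=
  Sum.elim c ![-e, -t]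

lemma lineWeights_ne_zero (hc : ∀ i, c i ≠ 0) (he : e ≠ 0) (ht : t ≠ 0) (w : Fin 4 ⊕ Fin 2) :
    lineWeights c e t w ≠ 0 := by
  rcases w with i | i
  · exact hc i
  · fin_cases i
    exacts [neg_ne_zero.2 he, neg_ne_zero.2 ht]

lemma sum_floor_lineWeights (hz : ∀ w, lineWeights c e t w ≠ 0) {s : ℝ} (hs : Irrational s) :
    ∑ w, ⌊s * lineWeights c e t w⌋ = ∑ i, ⌊s * c i⌋ - ⌊s * e⌋ - ⌊s * t⌋ - 2 := by
  have he : e ≠ 0 := neg_ne_zero.1 (hz (Sum.inr 0))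
  have ht : t ≠ 0 := neg_ne_zero.1 (hz (Sum.inr 1))
  simp only [lineWeights, Fintype.sum_sum_type, Sum.elim_inl, Sum.elim_inr, Fin.sum_univ_two,
    Matrix.cons_val_zero, Matrix.cons_val_one, floor_mul_neg hs he, floor_mul_neg hs ht]
  ring

lemma LineCondition.two_mul_sum_floor_le (h : LineCondition ε E 0 c) (he : ∑ i, ε i * c i = e)
    (ht : ∑ i, (1 - ε i) * c i = t) (hz : ∀ w, lineWeights c e t w ≠ 0) {s : ℝ}
    (hs : Irrational s) :
    2 * ∑ w, ⌊s * lineWeights c e t w⌋ ≤ -Fintype.card (Fin 4 ⊕ Fin 2) := by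
  have hle := h.sum_floor_le hs
  rw [he, ht] at hle
  rw [sum_floor_lineWeights hz hs, Fintype.card_sum, Fintype.card_fin, Fintype.card_fin]
  omega

lemma LineCondition.exists_eq_neg (h : LineCondition ε E 0 c) (he : ∑ i, ε i * c i = e)
    (ht : ∑ i, (1 - ε i) * c i = t) (hz : ∀ w, lineWeights c e t w ≠ 0) (i : Fin 4) :
    (∃ j, c j = -c i) ∨ e = c i ∨ t = c i := by
  obtain ⟨j | j, hj⟩ := exists_eq_neg_of_sum_floor_le hz
    (fun s hs => h.two_mul_sum_floor_le he ht hz hs) (Sum.inl i)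
  · exact Or.inl ⟨j, hj⟩
  · fin_cases j
    · exact Or.inr (Or.inl (neg_inj.1 hj))
    · exact Or.inr (Or.inr (neg_inj.1 hj))

lemma LineCondition.exists_sum_mul_floor_eq (h : LineCondition ε E 0 c) (he : ∑ i, ε i * c i = e)
    (ht : ∑ i, (1 - ε i) * c i = t) (hz : ∀ w, lineWeights c e t w ≠ 0) {s : ℝ}
    (hs : Irrational s) : ∃ n ∈ E, ∑ i, n i * c i = e ∧ ∑ i, n i * ⌊s * c i⌋ = ⌊s * e⌋ := by
  have heq := two_mul_sum_floor_eq hz (fun s hs => h.two_mul_sum_floor_le he ht hz hs) hs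
  rw [sum_floor_lineWeights hz hs, Fintype.card_sum, Fintype.card_fin, Fintype.card_fin] at heq
  obtain ⟨n, hn, hsum, hle⟩ := h s hs
  have hfloor := sum_mul_floor_le n c s
  rw [hsum, he] at hfloor
  rw [ht] at hle
  simp only [Pi.zero_apply, Nat.cast_zero, mul_zero, Finset.sum_const_zero, add_zero] at hle
  exact ⟨n, hn, hsum.trans he, by omega⟩

lemma LineCondition.exists_eq_zero_of_neg (h : LineCondition ε E 0 c) (he : ∑ i, ε i * c i = e)
    (ht : ∑ i, (1 - ε i) * c i = t) (hz : ∀ w, lineWeights c e t w ≠ 0) (hpos : 0 < e) :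
    ∃ n ∈ E, ∑ i, n i * c i = e ∧ ∀ i, c i < 0 → n i = 0 := by
  obtain ⟨s, hs, hsc, hse⟩ := exists_irrational_of_eventually
    ((eventually_all.2 fun i => eventually_floor_mul (c i)).and
      (eventually_floor_mul e))
  obtain ⟨n, hn, hsum, hfloor⟩ := h.exists_sum_mul_floor_eq he ht hz hs
  refine ⟨n, hn, hsum, ?_⟩
  rw [hse, if_neg hpos.not_gt] at hfloor
  simp only [hsc, mul_ite, mul_neg, mul_one, mul_zero] at hfloor
  rw [Finset.sum_eq_zero_iff_of_nonpos fun i _ => by split_ifs <;> simp] at hfloor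
  exact fun i hi => by simpa [hi] using hfloor i (Finset.mem_univ i)

lemma LineCondition.exists_sum_pos_eq_one (h : LineCondition ε E 0 c) (he : ∑ i, ε i * c i = e)
    (ht : ∑ i, (1 - ε i) * c i = t) (hz : ∀ w, lineWeights c e t w ≠ 0) (hpos : 0 < e) :
    ∃ n ∈ E, ∑ i, n i * c i = e ∧ ∑ i, (if 0 < c i then n i else 0) = 1 := by
  obtain ⟨s, hs, hsc, hse⟩ := exists_irrational_of_eventually
    ((eventually_all.2 fun i => eventually_floor_mul (-c i)).and
      (eventually_floor_mul (-e)))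
  obtain ⟨n, hn, hsum, hfloor⟩ := h.exists_sum_mul_floor_eq he ht hz hs.neg
  refine ⟨n, hn, hsum, ?_⟩
  simp only [Int.cast_neg, mul_neg, ← neg_mul, neg_lt_zero] at hsc hse
  rw [hse, if_pos hpos] at hfloor
  simp only [hsc, mul_ite, mul_neg, mul_one, mul_zero] at hfloor
  zify
  rw [← neg_inj, ← hfloor, ← Finset.sum_neg_distrib]
  exact Finset.sum_congr rfl fun i _ => by split_ifs <;> simp

end FourVariables

lemma exists_irrational_floor_eq {d d' : ℤ} (hd : 0 < d) (hdd' : d ≤ d') (hd' : d' < 2 * d) :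
    ∃ s : ℝ, Irrational s ∧ (∀ m : ℤ, 0 ≤ m → 2 * m ≤ d → ⌊s * m⌋ = 0) ∧
      ∀ m : ℤ, d ≤ m → m ≤ d' → ⌊s * m⌋ = 1 := by
  rify at hd hdd' hd'
  obtain ⟨s, hs, hlo, hhi⟩ := exists_irrational_btwn
    (show 1 / (d : ℝ) < 2 / d' by rw [div_lt_div_iff₀] <;> linarith)
  rw [div_lt_iff₀ hd] at hlo
  rw [lt_div_iff₀ (hd.trans_le hdd')] at hhi
  have hs₀ : 0 < s := pos_of_mul_pos_left (one_pos.trans hlo) hd.le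
  refine ⟨s, hs, fun m hm hmd => ?_, fun m hdm hmd' => Int.floor_eq_iff.2 ?_⟩
  · rify at hm hmd
    exact Int.floor_eq_zero_iff.2 ⟨by positivity, by nlinarith⟩
  · rify at hdm hmd'
    push_cast
    constructor <;> nlinarith

section CA

variable {c : Fin 4 → ℤ}

lemma mem_caExponents {n : Fin 4 → ℕ} :
    n ∈ caExponents ↔ n = ![1, 1, 0, 0] ∨ n 0 = 0 ∧ n 1 = 0 ∧ 2 ≤ n 2 + n 3 := by
  simp only [caExponents, tailExponents, Set.mem_insert_iff, Set.mem_ofPred_eq,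
    Set.mem_singleton_iff, Fin.forall_fin_succ, Fin.sum_univ_four]
  refine or_congr_right ⟨fun h => ?_, fun h => ?_⟩ <;> simp at h ⊢ <;> omega

lemma sum_caWeights (c : Fin 4 → ℤ) : ∑ i, ![1, 1, 0, 0] i * c i = c 0 + c 1 ∧
    ∑ i, (1 - ![1, 1, 0, 0] i) * c i = c 2 + c 3 := by
  simp [Fin.sum_univ_four]

lemma LineCondition.comp_swap_zero_one (h : LineCondition ![1, 1, 0, 0] caExponents 0 c) :
    LineCondition ![1, 1, 0, 0] caExponents 0 (c ∘ Equiv.swap 0 1) := by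
  refine h.comp_perm _ (by decide) rfl fun n hn => ?_
  rcases mem_caExponents.1 hn with rfl | hn
  · exact mem_caExponents.2 (Or.inl (by decide))
  · exact mem_caExponents.2 (Or.inr ⟨hn.2.1, hn.1, hn.2.2⟩)

lemma LineCondition.comp_swap_two_three (h : LineCondition ![1, 1, 0, 0] caExponents 0 c) :
    LineCondition ![1, 1, 0, 0] caExponents 0 (c ∘ Equiv.swap 2 3) := by
  refine h.comp_perm _ (by decide) rfl fun n hn => ?_
  rcases mem_caExponents.1 hn with rfl | hn
  · exact mem_caExponents.2 (Or.inl (by decide))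
  · exact mem_caExponents.2 (Or.inr ⟨hn.1, hn.2.1, hn.2.2.trans_eq (add_comm _ _)⟩)

lemma not_lineCondition_ca_opposite {q : ℤ} (hq : 2 ≤ q) :
    ¬ LineCondition ![1, 1, 0, 0] caExponents 0 ![q + 1, -1, -(q + 1), 1] := by
  intro h
  obtain ⟨s, hs, hzero, hone⟩ :=
    exists_irrational_floor_eq (d := q) (d' := q + 1) (by omega) (by omega) (by omega)
  obtain ⟨n, hn, -, hfloor⟩ := h.exists_sum_mul_floor_eq
    (sum_caWeights _).1 (sum_caWeights _).2 (lineWeights_ne_zero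
      (by simp [Fin.forall_fin_succ]; omega) (by simp; omega) (by simp; omega)) hs
  have hfloor_one : ⌊s * (1 : ℤ)⌋ = 0 := hzero _ (by omega) (by omega)
  have hfloor_q : ⌊s * q⌋ = 1 := hone _ (by omega) (by omega)
  have hfloor_succ : ⌊s * (q + 1 : ℤ)⌋ = 1 := hone _ (by omega) (by omega)
  rw [Fin.sum_univ_four] at hfloor
  simp only [Matrix.cons_val, floor_mul_neg hs one_ne_zero, floor_mul_neg hs (c := q + 1)
    (by omega), add_neg_cancel_right, hfloor_one, hfloor_q, hfloor_succ] at hfloor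
  rcases mem_caExponents.1 hn with rfl | ⟨h₀, h₁, -⟩
  · simp at hfloor
  · simp only [h₀, h₁] at hfloor
    omega

lemma not_lineCondition_ca_parallel {p : ℤ} (hp : 2 ≤ p) :
    ¬ LineCondition ![1, 1, 0, 0] caExponents 0 ![p + 1, -1, 1, p] := by
  intro h
  obtain ⟨s, hs, hzero, hone⟩ :=
    exists_irrational_floor_eq (d := p) (d' := p + 1) (by omega) (by omega) (by omega)
  obtain ⟨n, hn, hsum, hfloor⟩ := h.exists_sum_mul_floor_eq
    (sum_caWeights _).1 (sum_caWeights _).2 (lineWeights_ne_zero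
      (by simp [Fin.forall_fin_succ]; omega) (by simp; omega) (by simp; omega)) hs
  have hfloor_one : ⌊s * (1 : ℤ)⌋ = 0 := hzero _ (by omega) (by omega)
  have hfloor_p : ⌊s * p⌋ = 1 := hone _ (by omega) (by omega)
  have hfloor_succ : ⌊s * (p + 1 : ℤ)⌋ = 1 := hone _ (by omega) (by omega)
  rw [Fin.sum_univ_four] at hfloor hsum
  simp only [Matrix.cons_val, floor_mul_neg hs one_ne_zero, add_neg_cancel_right, hfloor_one,
    hfloor_p, hfloor_succ] at hfloor hsum
  rcases mem_caExponents.1 hn with rfl | ⟨h₀, h₁, hdeg⟩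
  · simp at hfloor
  · have h₃ : n 3 = 1 := by simp only [h₀, h₁] at hfloor; omega
    simp only [h₀, h₁, h₃] at hsum
    omega

lemma not_lineCondition_ca_of_add_eq_zero (hc : ∀ i, c i ≠ 0) (ht : c 2 + c 3 ≠ 0)
    (he : c 0 + c 1 = 0) :
    ¬ LineCondition ![1, 1, 0, 0] caExponents 0 c := by
  intro h
  have hcarry {s : ℝ} (hs : Irrational s) : ⌊s * c 2⌋ + ⌊s * c 3⌋ + 1 ≤ ⌊s * (c 2 + c 3 : ℤ)⌋ := by
    obtain ⟨n, hn, hsum, hle⟩ := h s hs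
    rw [(sum_caWeights c).1, he] at hsum
    simp only [(sum_caWeights c).2, Pi.zero_apply, Nat.cast_zero, mul_zero, Finset.sum_const_zero,
      add_zero] at hle
    rcases mem_caExponents.1 hn with rfl | ⟨h₀, h₁, hdeg⟩
    · simp only [Fin.sum_univ_four, Matrix.cons_val, Nat.cast_one, Nat.cast_zero, one_mul,
        zero_mul, add_zero] at hle
      omega
    · obtain ⟨i, hi⟩ : ∃ i, n i ≠ 0 := by
        by_contra! hzero
        simp [hzero] at hdeg
      have hneg := sum_mul_floor_neg hs hsum hi (hc i)
      have h₀₁ := floor_mul_neg hs (hc 0)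
      rw [show -c 0 = c 1 by omega] at h₀₁
      rw [Fin.sum_univ_four (f := fun i => ⌊s * c i⌋)] at hle
      omega
  have hpos := hcarry irrational_sqrt_two
  have hneg := hcarry irrational_sqrt_two.neg
  simp only [floor_neg_mul irrational_sqrt_two, hc, ht, ne_eq, not_false_eq_true] at hneg
  omega

lemma not_lineCondition_ca_of_pos_of_neg (hc : ∀ i, c i ≠ 0) (ht : c 2 + c 3 ≠ 0) (h₀ : 0 < c 0)
    (h₁ : 0 < c 1) (h₂ : c 2 < 0) : ¬ LineCondition ![1, 1, 0, 0] caExponents 0 c := by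
  intro h
  obtain ⟨he', ht'⟩ := sum_caWeights c
  have hz := lineWeights_ne_zero hc (by omega : c 0 + c 1 ≠ 0) ht
  obtain ⟨n, hn, hsum, hpos⟩ := h.exists_sum_pos_eq_one he' ht' hz (by omega)
  simp only [Fin.sum_univ_four, h₀, h₁, h₂.not_gt, if_true, if_false] at hpos
  rcases mem_caExponents.1 hn with rfl | ⟨hn₀, hn₁, hdeg⟩
  · simp at hpos
  obtain ⟨h₃, hn₃⟩ : 0 < c 3 ∧ n 3 = 1 := by split_ifs at hpos <;> omega
  have hlt : c 0 + c 1 < c 3 := by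
    rw [Fin.sum_univ_four, hn₀, hn₁, hn₃] at hsum
    have : (1 : ℤ) ≤ n 2 := by omega
    push_cast at hsum
    nlinarith
  rcases h.exists_eq_neg he' ht' hz 3 with ⟨j, hj⟩ | h' | h'
  · fin_cases j <;> simp at hj <;> omega
  all_goals omega

lemma not_lineCondition_ca_of_pos (hc : ∀ i, c i ≠ 0) (ht : c 2 + c 3 ≠ 0) (h₀ : 0 < c 0)
    (h₁ : 0 < c 1) : ¬ LineCondition ![1, 1, 0, 0] caExponents 0 c := by
  intro h
  rcases (hc 2).lt_or_gt with h₂ | h₂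
  · exact not_lineCondition_ca_of_pos_of_neg hc ht h₀ h₁ h₂ h
  rcases (hc 3).lt_or_gt with h₃ | h₃
  · exact not_lineCondition_ca_of_pos_of_neg (c := c ∘ Equiv.swap 2 3) (fun i => hc _)
      (by simpa [add_comm] using ht) h₀ h₁ h₃ h.comp_swap_two_three
  obtain ⟨n, hn, -, hpos⟩ := h.exists_sum_pos_eq_one (sum_caWeights c).1 (sum_caWeights c).2
    (lineWeights_ne_zero hc (by omega) ht) (by omega)
  simp only [Fin.sum_univ_four, h₀, h₁, h₂, h₃, if_true] at hpos
  rcases mem_caExponents.1 hn with rfl | ⟨hn₀, hn₁, hdeg⟩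
  · simp at hpos
  · omega

lemma exists_ca_exponents (hc : ∀ i, c i ≠ 0) (ht : c 2 + c 3 ≠ 0) (h₁ : c 1 < 0)
    (he : 0 < c 0 + c 1) (h : LineCondition ![1, 1, 0, 0] caExponents 0 c) :
    ∃ p q : ℕ, 2 ≤ p + q ∧ p * c 2 + q * c 3 = c 0 + c 1 ∧ (c 2 < 0 → p = 0) ∧
      (c 3 < 0 → q = 0) := by
  obtain ⟨n, hn, hsum, hzero⟩ := h.exists_eq_zero_of_neg (sum_caWeights c).1 (sum_caWeights c).2
    (lineWeights_ne_zero hc (by omega) ht) (by omega)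
  rcases mem_caExponents.1 hn with rfl | ⟨hn₀, hn₁, hdeg⟩
  · simpa using hzero 1 h₁
  · rw [Fin.sum_univ_four, hn₀, hn₁] at hsum
    exact ⟨n 2, n 3, hdeg, by simpa using hsum, hzero 2, hzero 3⟩

lemma not_lineCondition_ca_of_eq_neg (hc : ∀ i, c i ≠ 0) (ht : c 2 + c 3 ≠ 0) (h₁ : c 1 < 0)
    (he : 0 < c 0 + c 1) (h₂ : c 2 = -c 0) :
    ¬ LineCondition ![1, 1, 0, 0] caExponents 0 c := by
  intro h
  obtain ⟨he', ht'⟩ := sum_caWeights c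
  obtain ⟨p, q, hdeg, hsum, hp, -⟩ := exists_ca_exponents hc ht h₁ he h
  obtain rfl : p = 0 := hp (by omega)
  have hq : (2 : ℤ) ≤ q := by omega
  have h₀ : c 0 = q * c 3 - c 1 := by push_cast at hsum; linarith
  have h₃ : 0 < c 3 := pos_of_mul_pos_right (by linarith) (by positivity : (0 : ℤ) ≤ q)
  have hlt : c 3 < q * c 3 := by nlinarith
  have h₁₃ : c 1 = -c 3 := by
    rcases h.exists_eq_neg he' ht' (lineWeights_ne_zero hc he.ne' ht) 1 with ⟨j, hj⟩ | h' | h'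
    · fin_cases j <;> simp at hj <;> omega
    all_goals omega
  refine not_lineCondition_ca_opposite hq (LineCondition.of_smul (g := c 3) h₃.ne' ?_)
  convert h
  ext i
  fin_cases i <;> simp [h₂, h₀, h₁₃] <;> ring

lemma not_lineCondition_ca_of_sum_eq (hc : ∀ i, c i ≠ 0) (ht : c 2 + c 3 = c 0) (h₁ : c 1 < 0)
    (he : 0 < c 0 + c 1) (h₂ : c 2 = -c 1) :
    ¬ LineCondition ![1, 1, 0, 0] caExponents 0 c := by
  intro h
  obtain ⟨p, q, hdeg, hsum, -, -⟩ := exists_ca_exponents hc (by rw [ht]; exact hc 0) h₁ he h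
  have h₃ : c 3 = c 0 + c 1 := by omega
  obtain rfl : q = 0 := by
    by_contra hq
    rw [h₂, h₃] at hsum
    rcases (Nat.one_le_iff_ne_zero.2 hq).eq_or_lt with rfl | hq
    · have : (1 : ℤ) ≤ p := by omega
      push_cast at hsum
      nlinarith
    · have : (2 : ℤ) ≤ q := by exact_mod_cast hq
      nlinarith [mul_nonneg (Nat.cast_nonneg (α := ℤ) p) (neg_nonneg.2 h₁.le)]
  have hp : (2 : ℤ) ≤ p := by omega
  have hp₃ : c 3 = -(p * c 1) := by rw [h₂] at hsum; push_cast at hsum; linarith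
  have h₀ : c 0 = -c 1 + -(p * c 1) := by rw [← ht, h₂, hp₃]
  refine not_lineCondition_ca_parallel hp (LineCondition.of_smul (g := -c 1) (by omega) ?_)
  convert h
  ext i
  fin_cases i <;> simp [h₂, h₀, hp₃] <;> ring

lemma not_lineCondition_ca_of_neg (hc : ∀ i, c i ≠ 0) (ht : c 2 + c 3 ≠ 0) (h₁ : c 1 < 0)
    (he : 0 < c 0 + c 1) : ¬ LineCondition ![1, 1, 0, 0] caExponents 0 c := by
  intro h
  have hpair := h.exists_eq_neg (sum_caWeights c).1 (sum_caWeights c).2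
    (lineWeights_ne_zero hc he.ne' ht)
  have hc' (i : Fin 4) : (c ∘ Equiv.swap 2 3) i ≠ 0 := hc _
  have h₂₃ : c 2 = -c 0 ∨ c 3 = -c 0 ∨ c 2 + c 3 = c 0 := by
    rcases hpair 0 with ⟨j, hj⟩ | h' | h'
    · fin_cases j <;> simp at hj <;> omega
    all_goals omega
  rcases h₂₃ with h₂ | h₃ | h₂₃
  · exact not_lineCondition_ca_of_eq_neg hc ht h₁ he h₂ h
  · exact not_lineCondition_ca_of_eq_neg hc' (by simpa [add_comm] using ht) h₁ he h₃
      h.comp_swap_two_three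
  have h₂ : c 2 = -c 1 ∨ c 3 = -c 1 := by
    rcases hpair 1 with ⟨j, hj⟩ | h' | h'
    · fin_cases j <;> simp at hj <;> omega
    all_goals omega
  rcases h₂ with h₂ | h₃
  · exact not_lineCondition_ca_of_sum_eq hc h₂₃ h₁ he h₂ h
  · exact not_lineCondition_ca_of_sum_eq hc' ((add_comm _ _).trans h₂₃) h₁ he h₃
      h.comp_swap_two_three

lemma not_lineCondition_ca (hc : ∀ i, c i ≠ 0) (ht : c 2 + c 3 ≠ 0) :
    ¬ LineCondition ![1, 1, 0, 0] caExponents 0 c := by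
  intro h
  wlog he : 0 ≤ c 0 + c 1 generalizing c
  · exact this (c := -c) (fun i => neg_ne_zero.2 (hc i)) (by simp only [Pi.neg_apply]; omega) h.neg
      (by simp only [Pi.neg_apply]; omega)
  rcases he.eq_or_lt' with he | he
  · exact not_lineCondition_ca_of_add_eq_zero hc ht he h
  rcases (hc 1).lt_or_gt with h₁ | h₁
  · exact not_lineCondition_ca_of_neg hc ht h₁ he h
  rcases (hc 0).lt_or_gt with h₀ | h₀
  · exact not_lineCondition_ca_of_neg (c := c ∘ Equiv.swap 0 1) (fun i => hc _) ht h₀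
      (he.trans_eq (add_comm _ _)) h.comp_swap_zero_one
  · exact not_lineCondition_ca_of_pos hc ht h₀ h₁ h

end CA

section CDE

variable {c : Fin 4 → ℤ}

lemma mem_cdeExponents {n : Fin 4 → ℕ} :
    n ∈ cdeExponents ↔ n = Pi.single 0 2 ∨ n 0 = 0 ∧ 3 ≤ n 1 + n 2 + n 3 := by
  simp only [cdeExponents, tailExponents, Set.mem_insert_iff, Set.mem_ofPred_eq,
    Set.mem_singleton_iff, Fin.forall_fin_succ, Fin.sum_univ_four]
  refine or_congr_right ⟨fun h => ?_, fun h => ?_⟩ <;> simp at h ⊢ <;> omega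

lemma sum_cdeWeights (c : Fin 4 → ℤ) : ∑ i, (Pi.single 0 2 : Fin 4 → ℤ) i * c i = 2 * c 0 ∧
    ∑ i, (1 - (Pi.single 0 2 : Fin 4 → ℤ) i) * c i = c 1 + c 2 + c 3 - c 0 := by
  simp [Fin.sum_univ_four, Pi.single_apply]
  ring

lemma comp_perm_mem_cdeExponents (σ : Equiv.Perm (Fin 4)) (hσ : σ 0 = 0) {n : Fin 4 → ℕ}
    (hn : n ∈ cdeExponents) : n ∘ σ ∈ cdeExponents := by
  refine hn.imp (fun hn => ?_) (comp_mem_tailExponents σ fun i hi => ?_)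
  · rw [hn, Pi.single_comp_equiv, σ.symm_apply_eq.2 hσ.symm]
  · contrapose! hi
    obtain rfl : i = 0 := by fin_cases i <;> simp_all
    simp [hσ]

lemma LineCondition.comp_perm_cde {b : Fin 4 → ℕ}
    (h : LineCondition (Pi.single 0 2) cdeExponents b c) (σ : Equiv.Perm (Fin 4)) (hσ : σ 0 = 0)
    (hb : b ∘ σ = b) : LineCondition (Pi.single 0 2) cdeExponents b (c ∘ σ) := by
  refine h.comp_perm σ ?_ hb fun n => comp_perm_mem_cdeExponents σ hσ
  rw [Pi.single_comp_equiv, σ.symm_apply_eq.2 hσ.symm]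

lemma not_lineCondition_cde_opposite {u : ℤ} (hu : 2 ≤ u) :
    ¬ LineCondition (Pi.single 0 2) cdeExponents 0 ![-1, -(u + 2), u + 2, 1] := by
  intro h
  obtain ⟨s, hs, hzero, hone⟩ :=
    exists_irrational_floor_eq (d := u + 2) (d' := u + 2) (by omega) le_rfl (by omega)
  obtain ⟨n, hn, hsum, hfloor⟩ := h.exists_sum_mul_floor_eq (e := -2) (sum_cdeWeights _).1
    (sum_cdeWeights _).2 (lineWeights_ne_zero (by simp [Fin.forall_fin_succ]; omega) (by simp)
      (by simp)) hs
  have hfloor_one : ⌊s * (1 : ℤ)⌋ = 0 := hzero _ (by omega) (by omega)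
  have hfloor_two : ⌊s * (2 : ℤ)⌋ = 0 := hzero _ (by omega) (by omega)
  have hfloor_add : ⌊s * (u + 2 : ℤ)⌋ = 1 := hone _ (by omega) (by omega)
  rw [Fin.sum_univ_four] at hfloor hsum
  simp only [Matrix.cons_val, floor_mul_neg hs one_ne_zero, floor_mul_neg hs two_ne_zero,
    floor_mul_neg hs (c := u + 2) (by omega), hfloor_one, hfloor_two, hfloor_add] at hfloor hsum
  rcases mem_cdeExponents.1 hn with rfl | ⟨h₀, hdeg⟩
  · simp at hfloor
  · simp only [h₀] at hfloor hsum
    have h₂ : (n 2 : ℤ) = 2 * n 1 - 1 := by omega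
    have h₁ : (1 : ℤ) ≤ n 1 := by omega
    rw [h₂] at hsum
    push_cast at hsum
    nlinarith

lemma not_lineCondition_cde_parallel {q : ℤ} (hq : 2 ≤ q) :
    ¬ LineCondition (Pi.single 0 2) cdeExponents 0 ![-1, -(q + 2), 1, -2] := by
  intro h
  obtain ⟨s, hs, hzero, hone⟩ :=
    exists_irrational_floor_eq (d := q + 2) (d' := q + 2) (by omega) le_rfl (by omega)
  obtain ⟨n, hn, hsum, hfloor⟩ := h.exists_sum_mul_floor_eq (e := -2) (sum_cdeWeights _).1
    (sum_cdeWeights _).2 (lineWeights_ne_zero (by simp [Fin.forall_fin_succ]; omega) (by simp)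
      (by simp; omega)) hs
  have hfloor_one : ⌊s * (1 : ℤ)⌋ = 0 := hzero _ (by omega) (by omega)
  have hfloor_two : ⌊s * (2 : ℤ)⌋ = 0 := hzero _ (by omega) (by omega)
  have hfloor_add : ⌊s * (q + 2 : ℤ)⌋ = 1 := hone _ (by omega) (by omega)
  rw [Fin.sum_univ_four] at hfloor hsum
  simp only [Matrix.cons_val, floor_mul_neg hs one_ne_zero, floor_mul_neg hs two_ne_zero,
    floor_mul_neg hs (c := q + 2) (by omega), hfloor_one, hfloor_two, hfloor_add] at hfloor hsum
  rcases mem_cdeExponents.1 hn with rfl | ⟨h₀, hdeg⟩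
  · simp at hfloor
  · have h₁ : n 1 = 0 := by omega
    simp only [h₀, h₁] at hfloor hsum
    omega

lemma not_lineCondition_cde_of_eq_neg (hc : ∀ i, c i ≠ 0) (ht : c 1 + c 2 + c 3 - c 0 ≠ 0)
    (h₀ : 0 < c 0) (h₁ : 2 * c 0 < c 1) (h₂ : c 2 = -c 1) {p q : ℕ} (hdeg : 2 ≤ p + q)
    (hsum : c 1 + p * c 2 + q * c 3 = 2 * c 0) (hq : 0 < c 3 → q = 0) :
    ¬ LineCondition (Pi.single 0 2) cdeExponents 0 c := by
  intro h
  have hqc : q * c 3 ≤ 0 := by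
    rcases (hc 3).lt_or_gt with h₃ | h₃
    · exact mul_nonpos_of_nonneg_of_nonpos (by positivity) h₃.le
    · simp [hq h₃]
  obtain rfl : p = 0 := by
    by_contra hp
    have : (1 : ℤ) ≤ p := by omega
    rw [h₂] at hsum
    nlinarith
  have hq₂ : (2 : ℤ) ≤ q := by omega
  have h₃ : c 3 < 0 := lt_of_not_ge fun h₃ => by
    have := hq (h₃.lt_of_ne' (hc 3))
    omega
  have h₀₃ : c 3 = -c 0 := by
    rcases h.exists_eq_neg (sum_cdeWeights c).1 (sum_cdeWeights c).2
      (lineWeights_ne_zero hc (by omega) ht) 0 with ⟨j, hj⟩ | h' | h'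
    · fin_cases j <;> simp at hj <;> omega
    all_goals omega
  have h₁₀ : c 1 = (q + 2) * c 0 := by rw [h₀₃] at hsum; push_cast at hsum; linarith
  refine not_lineCondition_cde_opposite hq₂ (LineCondition.of_smul (g := -c 0) (by omega) ?_)
  convert h
  ext i
  fin_cases i <;> simp [h₂, h₁₀, h₀₃] <;> ring

lemma not_lineCondition_cde_of_sum_eq (hc : ∀ i, c i ≠ 0) (ht : c 2 + c 3 = c 0) (h₀ : 0 < c 0)
    (h₁ : 2 * c 0 < c 1) (h₃ : 0 < c 3) {p : ℕ} (hp : 2 ≤ p) (hsum : c 1 + p * c 2 = 2 * c 0) :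
    ¬ LineCondition (Pi.single 0 2) cdeExponents 0 c := by
  intro h
  have h₂ : c 2 = -c 0 := by
    rcases h.exists_eq_neg (sum_cdeWeights c).1 (sum_cdeWeights c).2
      (lineWeights_ne_zero hc (by omega) (by omega)) 0 with ⟨j, hj⟩ | h' | h'
    · fin_cases j <;> simp at hj <;> omega
    all_goals omega
  have h₁₀ : c 1 = (p + 2) * c 0 := by rw [h₂] at hsum; linarith
  have h₃₀ : c 3 = 2 * c 0 := by omega
  refine not_lineCondition_cde_parallel (q := p) (by omega)
    (LineCondition.of_smul (g := -c 0) (by omega) ?_)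
  convert h
  ext i
  fin_cases i <;> simp [h₂, h₁₀, h₃₀] <;> ring

lemma not_lineCondition_cde_of_exponents (hc : ∀ i, c i ≠ 0) (ht : c 1 + c 2 + c 3 - c 0 ≠ 0)
    (h₀ : 0 < c 0) {p q : ℕ} (hdeg : 2 ≤ p + q) (hsum : c 1 + p * c 2 + q * c 3 = 2 * c 0)
    (hp : 0 < c 2 → p = 0) (hq : 0 < c 3 → q = 0) :
    ¬ LineCondition (Pi.single 0 2) cdeExponents 0 c := by
  intro h
  have hneg {x : ℤ} {m : ℕ} (hx : x ≠ 0) (hm : 0 < x → m = 0) : m * x ≤ -m := by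
    rcases hx.lt_or_gt with hx | hx
    · nlinarith
    · simp [hm hx]
  have hpq : (2 : ℤ) ≤ p + q := by omega
  have h₁ : 2 * c 0 < c 1 := by linarith [hneg (hc 2) hp, hneg (hc 3) hq]
  have hswap := h.comp_perm_cde (Equiv.swap 2 3) (by decide) rfl
  have hc' (i : Fin 4) : (c ∘ Equiv.swap 2 3) i ≠ 0 := hc _
  have ht' : c 1 + c 3 + c 2 - c 0 ≠ 0 := by omega
  have hsum' : c 1 + q * c 3 + p * c 2 = 2 * c 0 := by linarith
  rcases h.exists_eq_neg (sum_cdeWeights c).1 (sum_cdeWeights c).2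
    (lineWeights_ne_zero hc (by omega) ht) 1 with ⟨j, hj⟩ | h' | h'
  · obtain h₂ | h₃ : c 2 = -c 1 ∨ c 3 = -c 1 := by fin_cases j <;> simp at hj <;> omega
    · exact not_lineCondition_cde_of_eq_neg hc ht h₀ h₁ h₂ hdeg hsum hq h
    · exact not_lineCondition_cde_of_eq_neg hc' ht' h₀ h₁ h₃ (by omega) hsum' hp hswap
  · omega
  have h₂₃ : c 2 + c 3 = c 0 := by omega
  rcases (hc 3).lt_or_gt with h₃ | h₃
  · have h₂ : 0 < c 2 := by omega
    obtain rfl : p = 0 := hp h₂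
    rw [Nat.cast_zero, zero_mul, add_zero] at hsum'
    exact not_lineCondition_cde_of_sum_eq hc' ((add_comm _ _).trans h₂₃) h₀ h₁ h₂ (by omega) hsum'
      hswap
  · obtain rfl : q = 0 := hq h₃
    rw [Nat.cast_zero, zero_mul, add_zero] at hsum
    exact not_lineCondition_cde_of_sum_eq hc h₂₃ h₀ h₁ h₃ (by omega) hsum h

lemma exists_cde_exponents (hc : ∀ i, c i ≠ 0) (ht : c 1 + c 2 + c 3 - c 0 ≠ 0) (h₀ : 0 < c 0)
    (h : LineCondition (Pi.single 0 2) cdeExponents 0 c) :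
    ∃ σ : Equiv.Perm (Fin 4), σ 0 = 0 ∧ ∃ p q : ℕ, 2 ≤ p + q ∧
      c (σ 1) + p * c (σ 2) + q * c (σ 3) = 2 * c 0 ∧ (0 < c (σ 2) → p = 0) ∧
      (0 < c (σ 3) → q = 0) := by
  obtain ⟨n, hn, hsum, hpos⟩ := h.exists_sum_pos_eq_one (sum_cdeWeights c).1
    (sum_cdeWeights c).2 (lineWeights_ne_zero hc (by omega) ht) (by omega)
  rw [Fin.sum_univ_four] at hsum hpos
  rcases mem_cdeExponents.1 hn with rfl | ⟨hn₀, hdeg⟩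
  · simp [h₀] at hpos
  simp only [hn₀, ite_self, zero_add, Nat.cast_zero, zero_mul] at hsum hpos
  obtain hn₁ | hn₂ | hn₃ : (if 0 < c 1 then n 1 else 0) = 1 ∨ (if 0 < c 2 then n 2 else 0) = 1 ∨
      (if 0 < c 3 then n 3 else 0) = 1 := by omega
  · refine ⟨1, rfl, n 2, n 3, ?_⟩
    simp only [Equiv.Perm.one_apply]
    grind
  · refine ⟨Equiv.swap 1 2, by decide, n 1, n 3, ?_⟩
    rw [show Equiv.swap (1 : Fin 4) 2 1 = 2 by decide,
      show Equiv.swap (1 : Fin 4) 2 2 = 1 by decide,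
      show Equiv.swap (1 : Fin 4) 2 3 = 3 by decide]
    grind
  · refine ⟨Equiv.swap 1 3, by decide, n 2, n 1, ?_⟩
    rw [show Equiv.swap (1 : Fin 4) 3 1 = 3 by decide,
      show Equiv.swap (1 : Fin 4) 3 2 = 2 by decide,
      show Equiv.swap (1 : Fin 4) 3 3 = 1 by decide]
    grind

lemma not_lineCondition_cde (hc : ∀ i, c i ≠ 0) (ht : c 1 + c 2 + c 3 - c 0 ≠ 0) :
    ¬ LineCondition (Pi.single 0 2) cdeExponents 0 c := by
  intro h
  wlog h₀ : 0 < c 0 generalizing c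
  · have hc₀ := hc 0
    exact this (c := -c) (fun i => neg_ne_zero.2 (hc i)) (by simp only [Pi.neg_apply]; omega) h.neg
      (by simp only [Pi.neg_apply]; omega)
  obtain ⟨σ, hσ, p, q, hdeg, hsum, hp, hq⟩ := exists_cde_exponents hc ht h₀ h
  have hsumσ : ∑ i, c (σ i) = ∑ i, c i := Equiv.sum_comp σ c
  simp only [Fin.sum_univ_four, hσ] at hsumσ
  refine not_lineCondition_cde_of_exponents (c := c ∘ σ) (fun i => hc _) ?_ ?_ hdeg ?_ hp hq
    (h.comp_perm_cde σ hσ rfl) <;> simp only [Function.comp_apply, hσ]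
  · omega
  · exact h₀
  · exact hsum

end CDE

section SumSq

variable {c : Fin 4 → ℤ}

lemma mem_sumSqExponents {n : Fin 4 → ℕ} :
    n ∈ sumSqExponents ↔ (n = Pi.single 0 2 ∨ n = Pi.single 1 2) ∨
      n 0 = 0 ∧ n 1 = 0 ∧ 3 ≤ n 2 + n 3 := by
  simp only [sumSqExponents, tailExponents, Set.mem_union, Set.mem_insert_iff, Set.mem_ofPred_eq,
    Set.mem_singleton_iff, Fin.forall_fin_succ, Fin.sum_univ_four]
  refine or_congr_right ⟨fun h => ?_, fun h => ?_⟩ <;> simp at h ⊢ <;> omega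

lemma sum_sumSqWeights (h₀₁ : c 1 = c 0) :
    ∑ i, (Pi.single 0 2 : Fin 4 → ℤ) i * c i = 2 * c 0 ∧
      ∑ i, (1 - (Pi.single 0 2 : Fin 4 → ℤ) i) * c i = c 2 + c 3 := by
  obtain ⟨he, ht⟩ := sum_cdeWeights c
  exact ⟨he, ht.trans (by rw [h₀₁]; ring)⟩

lemma LineCondition.comp_swap_sumSq (h : LineCondition (Pi.single 0 2) sumSqExponents 0 c) :
    LineCondition (Pi.single 0 2) sumSqExponents 0 (c ∘ Equiv.swap 2 3) := by
  refine h.comp_perm _ (by decide) rfl fun n hn => ?_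
  rcases mem_sumSqExponents.1 hn with (rfl | rfl) | hn
  · exact mem_sumSqExponents.2 (Or.inl (Or.inl (by decide)))
  · exact mem_sumSqExponents.2 (Or.inl (Or.inr (by decide)))
  · exact mem_sumSqExponents.2 (Or.inr ⟨hn.1, hn.2.1, hn.2.2.trans_eq (add_comm _ _)⟩)

lemma not_lineCondition_sumSq_of_exponents (hc : ∀ i, c i ≠ 0) (h₀₁ : c 1 = c 0)
    (ht : c 2 + c 3 ≠ 0) (h₀ : 0 < c 0) (h₃ : c 3 < 0) {q : ℕ} (hq : 2 ≤ q)
    (hsum : c 2 + q * c 3 = 2 * c 0) :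
    ¬ LineCondition (Pi.single 0 2) sumSqExponents 0 c := by
  intro h
  have h₂ : 2 * c 0 - 2 * c 3 ≤ c 2 := by
    have : (2 : ℤ) ≤ q := by exact_mod_cast hq
    nlinarith
  rcases h.exists_eq_neg (sum_sumSqWeights h₀₁).1 (sum_sumSqWeights h₀₁).2
    (lineWeights_ne_zero hc (by omega) ht) 2 with ⟨j, hj⟩ | h' | h'
  · fin_cases j <;> simp at hj <;> omega
  all_goals omega

lemma not_lineCondition_sumSq (hc : ∀ i, c i ≠ 0) (h₀₁ : c 1 = c 0) (ht : c 2 + c 3 ≠ 0) :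
    ¬ LineCondition (Pi.single 0 2) sumSqExponents 0 c := by
  intro h
  wlog h₀ : 0 < c 0 generalizing c
  · have hc₀ := hc 0
    refine this (c := -c) (fun i => neg_ne_zero.2 (hc i)) ?_ ?_ h.neg ?_ <;>
      simp only [Pi.neg_apply] <;> omega
  obtain ⟨n, hn, hsum, hpos⟩ := h.exists_sum_pos_eq_one (sum_sumSqWeights h₀₁).1
    (sum_sumSqWeights h₀₁).2 (lineWeights_ne_zero hc (by omega) ht) (by omega)
  rw [Fin.sum_univ_four] at hsum hpos
  rcases mem_sumSqExponents.1 hn with (rfl | rfl) | ⟨hn₀, hn₁, hdeg⟩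
  · simp [h₀] at hpos
  · simp [h₀₁, h₀] at hpos
  simp only [hn₀, hn₁, ite_self, zero_add, Nat.cast_zero, zero_mul] at hsum hpos
  rcases (hc 2).lt_or_gt with h₂ | h₂ <;> rcases (hc 3).lt_or_gt with h₃ | h₃ <;>
    simp only [h₂, h₃, h₂.not_gt, h₃.not_gt, if_true, if_false, zero_add, add_zero] at hpos
  · simp at hpos
  · rw [hpos, Nat.cast_one, one_mul, add_comm] at hsum
    exact not_lineCondition_sumSq_of_exponents (c := c ∘ Equiv.swap 2 3) (fun i => hc _) h₀₁
      ((add_comm _ _).trans_ne ht) h₀ h₂ (by omega) hsum h.comp_swap_sumSq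
  · rw [hpos, Nat.cast_one, one_mul] at hsum
    exact not_lineCondition_sumSq_of_exponents hc h₀₁ ht h₀ h₃ (by omega) hsum h
  · omega

end SumSq

section CDEUnit

variable {c : Fin 4 → ℤ}

lemma exists_floor_le_of_lineCondition_cde_unit (hc₀ : c 0 = 0) (hc : ∀ i ≠ 0, c i ≠ 0)
    (ht : c 1 + c 2 + c 3 ≠ 0) (h : LineCondition (Pi.single 0 2) cdeExponents (Pi.single 0 1) c)
    {s : ℝ} (hs : Irrational s) :
    2 * ∑ i, ⌊s * ![c 1, c 2, c 3, -(c 1 + c 2 + c 3)] i⌋ ≤ -4 ∧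
      (2 * ∑ i, ⌊s * ![c 1, c 2, c 3, -(c 1 + c 2 + c 3)] i⌋ = -4 →
        ∃ n : Fin 4 → ℕ, 3 ≤ n 1 + n 2 + n 3 ∧ n 1 * c 1 + n 2 * c 2 + n 3 * c 3 = 0 ∧
          -1 ≤ n 1 * ⌊s * c 1⌋ + n 2 * ⌊s * c 2⌋ + n 3 * ⌊s * c 3⌋) := by
  obtain ⟨n, hn, hsum, hle⟩ := h s hs
  obtain ⟨he, ht'⟩ := sum_cdeWeights c
  rw [he, hc₀, mul_zero] at hsum
  rw [ht', hc₀, sub_zero] at hle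
  have hsplit : ∑ i, ⌊s * ![c 1, c 2, c 3, -(c 1 + c 2 + c 3)] i⌋ =
      ⌊s * c 1⌋ + ⌊s * c 2⌋ + ⌊s * c 3⌋ - ⌊s * (c 1 + c 2 + c 3 : ℤ)⌋ - 1 := by
    rw [Fin.sum_univ_four]
    simp only [Matrix.cons_val, floor_mul_neg hs ht]
    ring
  rcases mem_cdeExponents.1 hn with rfl | ⟨hn₀, hdeg⟩
  · simp only [Fin.sum_univ_four, hc₀, Int.cast_zero, mul_zero, Int.floor_zero, zero_add,
      Pi.single_apply, Nat.cast_ite, Nat.cast_ofNat, Nat.cast_zero, Nat.cast_one, mul_ite, mul_one,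
      Finset.sum_ite_eq', Finset.mem_univ, if_true, ite_mul, zero_mul, add_zero] at hle
    rw [hsplit]
    omega
  · obtain ⟨i, hi₀, hi⟩ : ∃ i ≠ 0, n i ≠ 0 := by
      by_contra! hzero
      simp [hzero] at hdeg
    have hneg := sum_mul_floor_neg hs hsum hi (hc i hi₀)
    simp only [Fin.sum_univ_four, hc₀, hn₀, Int.cast_zero, Nat.cast_zero, mul_zero,
      Int.floor_zero, zero_add, Pi.single_apply, Fin.reduceEq, if_true, if_false, Nat.cast_one,
      add_zero] at hle hneg hsum
    rw [hsplit]
    exact ⟨by omega, fun heq => ⟨n, hdeg, hsum, by omega⟩⟩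

lemma weights_ne_zero_of_cde_unit (hc : ∀ i ≠ 0, c i ≠ 0) (ht : c 1 + c 2 + c 3 ≠ 0) (i : Fin 4) :
    ![c 1, c 2, c 3, -(c 1 + c 2 + c 3)] i ≠ 0 := by
  fin_cases i
  exacts [hc 1 (by decide), hc 2 (by decide), hc 3 (by decide), neg_ne_zero.2 ht]

lemma exists_exponents_of_lineCondition_cde_unit (hc₀ : c 0 = 0) (hc : ∀ i ≠ 0, c i ≠ 0)
    (ht : c 1 + c 2 + c 3 ≠ 0) (h : LineCondition (Pi.single 0 2) cdeExponents (Pi.single 0 1) c)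
    {s : ℝ} (hs : Irrational s) :
    ∃ n : Fin 4 → ℕ, 3 ≤ n 1 + n 2 + n 3 ∧ n 1 * c 1 + n 2 * c 2 + n 3 * c 3 = 0 ∧
      -1 ≤ n 1 * ⌊s * c 1⌋ + n 2 * ⌊s * c 2⌋ + n 3 * ⌊s * c 3⌋ :=
  (exists_floor_le_of_lineCondition_cde_unit hc₀ hc ht h hs).2
    (two_mul_sum_floor_eq (weights_ne_zero_of_cde_unit hc ht)
      (fun _ hs => (exists_floor_le_of_lineCondition_cde_unit hc₀ hc ht h hs).1) hs)

lemma add_eq_zero_of_lineCondition_cde_unit (hc₀ : c 0 = 0) (hc : ∀ i ≠ 0, c i ≠ 0)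
    (ht : c 1 + c 2 + c 3 ≠ 0)
    (h : LineCondition (Pi.single 0 2) cdeExponents (Pi.single 0 1) c) :
    c 1 + c 2 = 0 ∨ c 1 + c 3 = 0 ∨ c 2 + c 3 = 0 := by
  obtain ⟨j, hj⟩ := exists_eq_neg_of_sum_floor_le (weights_ne_zero_of_cde_unit hc ht)
    (fun _ hs => (exists_floor_le_of_lineCondition_cde_unit hc₀ hc ht h hs).1) 0
  have hc₁ := hc 1 (by decide)
  fin_cases j <;> simp at hj <;> omega

lemma not_lineCondition_cde_unit_of_pos (hc₀ : c 0 = 0) (h₁ : 0 < c 1) (h₂ : c 2 = -c 1)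
    (h₃ : 0 < c 3) : ¬ LineCondition (Pi.single 0 2) cdeExponents (Pi.single 0 1) c := by
  intro h
  have hc : ∀ i ≠ 0, c i ≠ 0 := by
    intro i hi
    fin_cases i <;> simp at hi ⊢ <;> omega
  have hexp {s : ℝ} (hs : Irrational s) :=
    exists_exponents_of_lineCondition_cde_unit hc₀ hc (by omega) h hs
  have hneg₂ : c 2 < 0 := by omega
  have h₃₁ : 2 * c 3 ≤ c 1 := by
    obtain ⟨s, hs, hfloor⟩ := exists_irrational_of_eventually
      (eventually_all.2 fun i => eventually_floor_mul (c i))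
    obtain ⟨n, hdeg, hsum, hle⟩ := hexp hs
    simp only [hfloor, h₁.not_gt, h₃.not_gt, hneg₂, if_true, if_false] at hle
    rw [h₂] at hsum
    have hn₃ : (n 3 : ℤ) ≤ n 3 * c 3 := by nlinarith
    obtain ⟨hn₁, hn₂⟩ : n 1 = 0 ∧ n 2 = 1 := by
      by_contra hn
      nlinarith [mul_le_mul_of_nonneg_left (show 1 ≤ c 1 by omega)
        (show (0 : ℤ) ≤ n 1 - n 2 by omega)]
    rw [hn₁, hn₂] at hsum
    have : (2 : ℤ) ≤ n 3 := by omega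
    push_cast at hsum
    nlinarith
  have h₁₃ : 2 * c 1 ≤ c 3 := by
    obtain ⟨s, hs, hfloor⟩ := exists_irrational_of_eventually
      (eventually_all.2 fun i => eventually_floor_mul (-c i))
    obtain ⟨n, hdeg, hsum, hle⟩ := hexp hs.neg
    simp only [Int.cast_neg, mul_neg, ← neg_mul, neg_lt_zero] at hfloor
    simp only [hfloor, h₁, h₃, hneg₂.not_gt, if_true, if_false] at hle
    rw [h₂] at hsum
    have hn₂ : (2 : ℤ) ≤ n 2 := by omega
    have hn₃ : n 3 = 1 ∧ n 1 = 0 := by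
      by_contra hn
      have hn₃ : n 3 = 0 := by omega
      have hn₁ : (n 1 : ℤ) < n 2 := by omega
      rw [hn₃, Nat.cast_zero] at hsum
      nlinarith
    rw [hn₃.1, hn₃.2] at hsum
    push_cast at hsum
    nlinarith
  omega

lemma not_lineCondition_cde_unit_of_eq_neg (hc₀ : c 0 = 0) (h₁ : c 1 ≠ 0) (h₂ : c 2 = -c 1)
    (h₃ : c 3 ≠ 0) : ¬ LineCondition (Pi.single 0 2) cdeExponents (Pi.single 0 1) c := by
  intro h
  wlog h₃' : 0 < c 3 generalizing c
  · exact this (c := -c) (neg_eq_zero.2 hc₀) (neg_ne_zero.2 h₁) (neg_inj.2 h₂) (neg_ne_zero.2 h₃)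
      h.neg (by simp only [Pi.neg_apply]; omega)
  rcases h₁.lt_or_gt with h₁ | h₁
  · exact not_lineCondition_cde_unit_of_pos (c := c ∘ Equiv.swap 1 2) hc₀
      (by change 0 < c 2; omega) (by change c 1 = -c 2; omega) h₃'
      (h.comp_perm_cde _ (by decide) (by decide))
  · exact not_lineCondition_cde_unit_of_pos hc₀ h₁ h₂ h₃' h

lemma not_lineCondition_cde_unit (hc₀ : c 0 = 0) (hc : ∀ i ≠ 0, c i ≠ 0)
    (ht : c 1 + c 2 + c 3 ≠ 0) :
    ¬ LineCondition (Pi.single 0 2) cdeExponents (Pi.single 0 1) c := by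
  intro h
  have h₁ := hc 1 (by decide)
  have h₂ := hc 2 (by decide)
  have h₃ := hc 3 (by decide)
  rcases add_eq_zero_of_lineCondition_cde_unit hc₀ hc ht h with h₁₂ | h₁₃ | h₂₃
  · exact not_lineCondition_cde_unit_of_eq_neg hc₀ h₁ (by omega) h₃ h
  · exact not_lineCondition_cde_unit_of_eq_neg (c := c ∘ Equiv.swap 2 3) hc₀ h₁
      (by change c 3 = -c 1; omega) h₂ (h.comp_perm_cde _ (by decide) (by decide))
  · exact not_lineCondition_cde_unit_of_eq_neg (c := c ∘ Equiv.swap 1 3) hc₀ h₃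
      (by change c 2 = -c 3; omega) h₁ (h.comp_perm_cde _ (by decide) (by decide))

end CDEUnit

section Torsion

lemma fract_div_eq_of_dvd {r : ℕ} (hr : 0 < r) {u v : ℤ} (h : (r : ℤ) ∣ u - v) :
    Int.fract ((u : ℝ) / r) = Int.fract ((v : ℝ) / r) := by
  obtain ⟨q, hq⟩ := h
  have hqR : (u : ℝ) - v = r * q := by exact_mod_cast hq
  exact Int.fract_eq_fract.2 ⟨q, by field_simp; exact hqR⟩

lemma fract_div_pos {r : ℕ} (hr : 0 < r) {x : ℤ} (hx : ¬ (r : ℤ) ∣ x) :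
    0 < Int.fract ((x : ℝ) / r) := by
  refine (Int.fract_nonneg _).lt_of_ne' fun h => hx ?_
  obtain ⟨z, hz⟩ := Int.fract_eq_zero_iff.1 h
  rw [eq_div_iff (by positivity)] at hz
  exact ⟨z, by rw [mul_comm]; exact_mod_cast hz.symm⟩

lemma mul_fract_div_le {r N : ℕ} (hr : 0 < r) (hN : 0 < N) {x : ℤ} (hx : (r : ℤ) ∣ N * x) :
    N * Int.fract ((x : ℝ) / r) ≤ N - 1 := by
  obtain ⟨q, hq⟩ := hx
  have hqR : (N : ℝ) * x = r * q := by exact_mod_cast hq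
  have hint : N * Int.fract ((x : ℝ) / r) = (q - N * ⌊(x : ℝ) / r⌋ : ℤ) := by
    rw [Int.fract, mul_sub, mul_div_assoc', hqR, mul_div_cancel_left₀ _ (by positivity)]
    push_cast
    rfl
  have hlt : N * Int.fract ((x : ℝ) / r) < N :=
    mul_lt_of_lt_one_right (by positivity) (Int.fract_lt_one _)
  rw [hint] at hlt ⊢
  have hle : q - N * ⌊(x : ℝ) / r⌋ ≤ (N : ℤ) - 1 := Int.le_sub_one_of_lt (by exact_mod_cast hlt)
  exact_mod_cast hle

lemma exists_half_le_fract_mul {x : ℝ} (hx : 0 < Int.fract x) :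
    ∃ l : ℕ, 1 / 2 ≤ Int.fract (l * x) := by
  set y := Int.fract x with hy
  by_cases h : 1 / 2 ≤ y
  · exact ⟨1, by rwa [Nat.cast_one, one_mul]⟩
  set l := ⌈1 / (2 * y)⌉₊
  have hmul : 1 / (2 * y) * y = 1 / 2 := by field_simp
  have hlow : 1 / 2 ≤ l * y := by
    rw [← hmul]; gcongr; exact Nat.le_ceil _
  have hhigh : l * y < 1 := by
    have := mul_lt_mul_of_pos_right (Nat.ceil_lt_add_one (by positivity : 0 ≤ 1 / (2 * y))) hx
    linarith
  have hfract : Int.fract (l * x) = l * y := by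
    refine Int.fract_eq_iff.2 ⟨by linarith, hhigh, l * ⌊x⌋, ?_⟩
    rw [hy, Int.fract]; push_cast; ring
  exact ⟨l, hlow.trans_eq hfract.symm⟩

lemma exists_modEq_notMem_of_card_le {r N k : ℕ} (hN : 0 < N) (hr : N * (k + 1) ≤ r) (l : ℕ)
    {J : Finset ℕ} (hJ : J.card ≤ k) :
    ∃ j ∉ J, j < r ∧ r ≤ j + N * (k + 1) ∧ j ≡ l [MOD N] := by
  have hcard : J.card < ((Finset.Ico (r - N * (k + 1)) r).filter (· ≡ l [MOD N])).card := by
    have hcount := Nat.Ico_filter_modEq_card (r - N * (k + 1)) r hN l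
    have hshift : ((r : ℚ) - l) / N = ((r - N * (k + 1) : ℕ) - l) / N + (k + 1 : ℕ) := by
      push_cast [Nat.cast_sub hr]; field_simp; ring
    rw [hshift, Int.ceil_add_natCast, add_sub_cancel_left] at hcount
    omega
  obtain ⟨j, hj, hjJ⟩ := Finset.exists_mem_notMem_of_card_lt_card hcard
  obtain ⟨hjr, hjl⟩ := Finset.mem_filter.1 hj
  rw [Finset.mem_Ico] at hjr
  exact ⟨j, hjJ, hjr.2, by omega, hjl⟩

/-- Multiples of a torsion element `x` depend on `j` only modulo `N`, so `j` can be taken close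
to `r`. -/
lemma exists_half_le_fract_le_sub {r N k : ℕ} (hN : 0 < N) (hr : N * N * (k + 2) ≤ r) {x : ℤ}
    (hx : ¬ (r : ℤ) ∣ x) (hNx : (r : ℤ) ∣ N * x) {J : Finset ℕ} (hJ : J.card ≤ k) :
    ∃ j ∉ J, 0 < j ∧ j < r ∧ 1 / 2 ≤ Int.fract (j * x / r : ℝ) ∧
      (N / r : ℝ) ≤ j / r - Int.fract (j * x / r : ℝ) := by
  have hNN : N * (k + 1) < N * N * (k + 2) := by
    rw [mul_assoc]
    exact Nat.mul_lt_mul_of_pos_left (by nlinarith) hN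
  have hr₀ : 0 < r := by omega
  obtain ⟨l, hl⟩ := exists_half_le_fract_mul (fract_div_pos hr₀ hx)
  obtain ⟨j, hjJ, hjr, hjlow, hjl⟩ := exists_modEq_notMem_of_card_le hN (hNN.le.trans hr) l hJ
  have hdvd : (r : ℤ) ∣ j * x - l * x := by
    rw [← sub_mul]
    exact hNx.trans (mul_dvd_mul_right (Nat.modEq_iff_dvd.1 hjl.symm) x)
  have hfract : Int.fract (j * x / r : ℝ) = Int.fract (l * (x / r : ℝ)) := by
    have := fract_div_eq_of_dvd hr₀ hdvd
    push_cast at this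
    rw [this, mul_div_assoc]
  refine ⟨j, hjJ, by omega, hjr, by rwa [hfract], ?_⟩
  have hle := mul_fract_div_le hr₀ hN (x := j * x) (by rw [mul_left_comm]; exact hNx.mul_left _)
  push_cast at hle
  have hNR : (0 : ℝ) < N := Nat.cast_pos.2 hN
  have hrR : (0 : ℝ) < r := Nat.cast_pos.2 hr₀
  have hjR : (r : ℝ) ≤ j + N * (k + 1) := by exact_mod_cast hjlow
  have hr' : (N * N * (k + 2) : ℝ) ≤ r := by exact_mod_cast hr
  rw [le_sub_iff_add_le, ← le_sub_iff_add_le', ← sub_div, le_div_iff₀ hrR]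
  refine le_of_mul_le_mul_left ?_ hNR
  nlinarith [mul_le_mul_of_nonneg_left hle hrR.le, mul_le_mul_of_nonneg_left hjR hNR.le]

lemma fract_mul_div_eq_sub {r j : ℕ} (hjr : j < r) {x y : ℤ} (hxy : (r : ℤ) ∣ x + y - 1)
    (hle : Int.fract (j * x / r : ℝ) ≤ j / r) :
    Int.fract (j * y / r : ℝ) = j / r - Int.fract (j * x / r : ℝ) := by
  have hrR : (0 : ℝ) < r := Nat.cast_pos.2 (by omega)
  have hj : (j / r : ℝ) < 1 := (div_lt_one hrR).2 (Nat.cast_lt.2 hjr)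
  obtain ⟨q, hq⟩ := hxy
  have hqR : (x : ℝ) + y - 1 = r * q := by exact_mod_cast hq
  refine Int.fract_eq_iff.2 ⟨sub_nonneg.2 hle, ?_, j * q - ⌊(j * x / r : ℝ)⌋, ?_⟩
  · linarith [Int.fract_nonneg (j * x / r : ℝ)]
  · rw [Int.fract]
    push_cast
    field_simp
    linear_combination (j : ℝ) * hqR

lemma one_le_mul_add_mul {r N p q : ℕ} (hN : 0 < N) {x y : ℝ} (hx : 1 / 2 ≤ x)
    (hy : (N / r : ℝ) ≤ y) (hpq : 2 ≤ p + q) (hdvd : r ∣ N * q) : 1 ≤ p * x + q * y := by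
  have : 0 ≤ y := (by positivity : (0 : ℝ) ≤ N / r).trans hy
  rcases q.eq_zero_or_pos with rfl | hq
  · have hp : (2 : ℝ) ≤ p := by exact_mod_cast hpq
    push_cast
    nlinarith
  · have hNq : 0 < N * q := Nat.mul_pos hN hq
    have hr : (0 : ℝ) < r := Nat.cast_pos.2 (Nat.pos_of_dvd_of_pos hdvd hNq)
    have hle : (r : ℝ) ≤ N * q := by exact_mod_cast Nat.le_of_dvd hNq hdvd
    calc (1 : ℝ) ≤ q * (N / r) := by rw [mul_div_assoc', le_div_iff₀ hr]; linarith
      _ ≤ q * y := by gcongr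
      _ ≤ p * x + q * y := le_add_of_nonneg_left (mul_nonneg p.cast_nonneg (by linarith))

variable {k r N : ℕ} {a : Fin 4 → ℤ} {S : Set (Fin 4 → ℕ)} {i i' : Fin 4}

lemma dvd_add_sub_one_ca (hadm : Admissible k r a ![1, 1, 0, 0] S)
    (hi : i = 2 ∧ i' = 3 ∨ i = 3 ∧ i' = 2) : (r : ℤ) ∣ a i + a i' - 1 := by
  refine hadm.dvd_sum_sub_one.trans (dvd_of_eq ?_)
  rw [(sum_caWeights a).2]
  rcases hi with ⟨rfl, rfl⟩ | ⟨rfl, rfl⟩ <;> ring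

lemma dvd_mul_of_dvd_mul_ca (hadm : Admissible k r a ![1, 1, 0, 0] S)
    (hi : i = 2 ∧ i' = 3 ∨ i = 3 ∧ i' = 2) (hNa : (r : ℤ) ∣ N * a i) {n : Fin 4 → ℕ} (hn : n ∈ S)
    (h₀ : n 0 = 0) (h₁ : n 1 = 0) : (r : ℤ) ∣ N * n i' := by
  have hsum : (r : ℤ) ∣ n i' * a i' + n i * a i - a 0 - a 1 := by
    refine (hadm.dvd_exponent n hn).trans (dvd_of_eq ?_)
    rcases hi with ⟨rfl, rfl⟩ | ⟨rfl, rfl⟩ <;>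
    · simp [Fin.sum_univ_four, h₀, h₁]; ring
  have hexp := hadm.dvd_mul_sum i N hNa
  rw [(sum_caWeights a).1] at hexp
  obtain ⟨u, hu⟩ := hsum
  obtain ⟨v, hv⟩ := hexp
  obtain ⟨w, hw⟩ := dvd_add_sub_one_ca hadm hi
  obtain ⟨y, hy⟩ := hNa
  exact ⟨N * u + v - n i * y - N * n i' * w + n i' * y, by
    linear_combination (N : ℤ) * hu + hv - (n i : ℤ) * hy - N * n i' * hw + n i' * hy⟩

lemma lt_of_dvd_mul_ca (hadm : Admissible k r a ![1, 1, 0, 0] S) (hS : S ⊆ caExponents)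
    (hN : 0 < N) (hi : i = 2 ∧ i' = 3 ∨ i = 3 ∧ i' = 2) (hNa : (r : ℤ) ∣ N * a i)
    (ha : ¬ (r : ℤ) ∣ a i) : r < N * N * (k + 2) := by
  by_contra! hr
  obtain ⟨J, hJ, hex⟩ := hadm.exists_exceptions 0
  obtain ⟨j, hjJ, hj₀, hjr, hhalf, hsub⟩ := exists_half_le_fract_le_sub hN hr ha hNa hJ
  obtain ⟨n, hn, hle⟩ := hex j hj₀ hjr hjJ
  have hfract' := fract_mul_div_eq_sub hjr (dvd_add_sub_one_ca hadm hi)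
    (sub_nonneg.1 ((by positivity : (0 : ℝ) ≤ N / r).trans hsub))
  have hsplit (g : Fin 4 → ℝ) : ∑ i, g i = g 0 + g 1 + g i + g i' := by
    rw [Fin.sum_univ_four]
    rcases hi with ⟨rfl, rfl⟩ | ⟨rfl, rfl⟩ <;> ring
  simp only [Pi.zero_apply, Nat.cast_zero, add_zero] at hle
  rw [hsplit, hsplit, hfract'] at hle
  have hlt₀ := Int.fract_lt_one (j * a 0 / r : ℝ)
  have hlt₁ := Int.fract_lt_one (j * a 1 / r : ℝ)
  rcases mem_caExponents.1 (hS hn) with rfl | ⟨h₀, h₁, hdeg⟩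
  · rcases hi with ⟨rfl, rfl⟩ | ⟨rfl, rfl⟩ <;>
    · simp only [Matrix.cons_val, Nat.cast_one, Nat.cast_zero] at hle
      linarith
  · have hdeg' : 2 ≤ n i + n i' := by rcases hi with ⟨rfl, rfl⟩ | ⟨rfl, rfl⟩ <;> omega
    have hone := one_le_mul_add_mul hN hhalf hsub hdeg'
      (by exact_mod_cast dvd_mul_of_dvd_mul_ca hadm hi hNa hn h₀ h₁)
    simp only [h₀, h₁, Nat.cast_zero, zero_mul, zero_add] at hle
    linarith

end Torsion

section Bound

lemma exists_bound_ca (k : ℕ) : ∃ R : ℕ, ∀ r a S, (Admissible k r a ![1, 1, 0, 0] S ∧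
    S ⊆ caExponents ∧ ¬ (r : ℤ) ∣ a 2 ∧ ¬ (r : ℤ) ∣ a 3) → r ≤ R := by
  refine exists_bound_of_forall_hyperfilter fun r a S hr h => ?_
  have hadm := fun x => (h x).1
  obtain ⟨c, N, hc, ht⟩ := exists_isLimitLine_of_admissible hr hadm
  have htail {i i' : Fin 4} (hi : i = 2 ∧ i' = 3 ∨ i = 3 ∧ i' = 2) : c i ≠ 0 := by
    intro hci
    obtain ⟨x, hx, hlt⟩ :=
      (hc.eventually_dvd.and (hr.eventually_gt_atTop (N * N * (k + 2)))).exists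
    refine hlt.not_gt (lt_of_dvd_mul_ca (hadm x) (h x).2.1 hc.pos hi (hx i hci) ?_)
    rcases hi with ⟨rfl, -⟩ | ⟨rfl, -⟩
    exacts [(h x).2.2.1, (h x).2.2.2]
  have hhead {i : Fin 4} (hci : c i = 0) : c 0 + c 1 = 0 := by
    rw [← (sum_caWeights c).1]; exact hc.sum_mul_eq_zero_of_eq_zero hadm hci
  have h₀ : c 0 ≠ 0 := fun h₀ =>
    hc.ne_zero_of_eq_zero hr hadm (i := 0) (j := 1) (by decide) h₀ (by have := hhead h₀; omega)
  have h₁ : c 1 ≠ 0 := fun h₁ =>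
    hc.ne_zero_of_eq_zero hr hadm (i := 1) (j := 0) (by decide) h₁ (by have := hhead h₁; omega)
  have hc₀ : ∀ i, c i ≠ 0 := by
    intro i
    fin_cases i
    exacts [h₀, h₁, htail (Or.inl ⟨rfl, rfl⟩), htail (Or.inr ⟨rfl, rfl⟩)]
  exact not_lineCondition_ca hc₀ ((sum_caWeights c).2 ▸ ht)
    (hc.lineCondition hr hadm (fun x => (h x).2.1) ht fun i => Or.inl (hc₀ i))

lemma exists_bound_sumSq (k : ℕ) : ∃ R : ℕ, ∀ r a S, (Admissible k r a (Pi.single 0 2) S ∧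
    S ⊆ sumSqExponents ∧ Pi.single 1 2 ∈ S) → r ≤ R := by
  refine exists_bound_of_forall_hyperfilter fun r a S hr h => ?_
  have hadm := fun x => (h x).1
  obtain ⟨c, N, hc, ht⟩ := exists_isLimitLine_of_admissible hr hadm
  have h₀₁ : c 1 = c 0 := by
    have := sum_mul_eq_of_eventually_mem hadm hc (m := Pi.single 1 2)
      (Eventually.of_forall fun x => ⟨_, (h x).2.2, fun _ _ => rfl⟩)
    simpa [Pi.single_apply] using this
  have hhead {i : Fin 4} (hci : c i = 0) : c 0 = 0 := by
    have := (sum_cdeWeights c).1.symm.trans (hc.sum_mul_eq_zero_of_eq_zero hadm hci)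
    omega
  have hc₀ (i : Fin 4) : c i ≠ 0 := fun hci =>
    hc.ne_zero_of_eq_zero hr hadm (i := 0) (j := 1) (by decide) (hhead hci)
      (h₀₁.trans (hhead hci))
  exact not_lineCondition_sumSq hc₀ h₀₁ ((sum_sumSqWeights h₀₁).2 ▸ ht)
    (hc.lineCondition hr hadm (fun x => (h x).2.1) ht fun i => Or.inl (hc₀ i))

lemma exists_bound_cde (k : ℕ) : ∃ R : ℕ, ∀ r a S, (Admissible k r a (Pi.single 0 2) S ∧
    S ⊆ cdeExponents) → r ≤ R := by
  refine exists_bound_of_forall_hyperfilter fun r a S hr h => ?_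
  have hadm := fun x => (h x).1
  obtain ⟨c, N, hc, ht⟩ := exists_isLimitLine_of_admissible hr hadm
  have ht' := (sum_cdeWeights c).2 ▸ ht
  have hne : ∀ i ≠ 0, c i ≠ 0 := by
    intro i hi hci
    have := (sum_cdeWeights c).1.symm.trans (hc.sum_mul_eq_zero_of_eq_zero hadm hci)
    exact hc.ne_zero_of_eq_zero hr hadm hi hci (by omega)
  have hline := fun b => hc.lineCondition hr hadm (fun x => (h x).2) ht (b := b)
  by_cases h₀ : c 0 = 0
  · refine not_lineCondition_cde_unit h₀ hne (by rwa [h₀, sub_zero] at ht') (hline _ fun i => ?_)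
    by_cases hi : i = 0
    · exact Or.inr (by simp [hi])
    · exact Or.inl (hne i hi)
  · have hc₀ (i : Fin 4) : c i ≠ 0 := by
      by_cases hi : i = 0
      · rwa [hi]
      · exact hne i hi
    exact not_lineCondition_cde hc₀ ht' (hline _ fun i => Or.inl (hc₀ i))

lemma modEq_of_dvd_ca {k r : ℕ} {a : Fin 4 → ℤ} {S : Set (Fin 4 → ℕ)} {i i' : Fin 4}
    (hadm : Admissible k r a ![1, 1, 0, 0] S) (hi : i = 2 ∧ i' = 3 ∨ i = 3 ∧ i' = 2)
    (h : (r : ℤ) ∣ a i) :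
    Int.gcd (a 0) r = 1 ∧ a 1 ≡ -a 0 [ZMOD r] ∧ a i ≡ 0 [ZMOD r] ∧ a i' ≡ 1 [ZMOD r] := by
  refine ⟨?_, ?_, Int.modEq_zero_iff_dvd.2 h, ?_⟩
  · obtain ⟨t, ht⟩ := Int.gcd_dvd_left (a 0) r
    obtain ⟨m, hm⟩ := Int.gcd_dvd_right (a 0) r
    have hm₀ : m ≠ 0 := by
      rintro rfl
      have := hadm.r_pos
      omega
    have hdvd : (r : ℤ) ∣ m := hadm.dvd_of_dvd_mul 0 i
      (by rcases hi with ⟨rfl, -⟩ | ⟨rfl, -⟩ <;> decide) m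
      ⟨t, by linear_combination m * ht - t * hm⟩ (h.mul_left m)
    have hunit : (Int.gcd (a 0) r : ℤ) * m ∣ 1 * m := by rwa [← hm, one_mul]
    exact Nat.dvd_one.1 (by exact_mod_cast (mul_dvd_mul_iff_right hm₀).1 hunit)
  · have hexp := hadm.dvd_mul_sum i 1 (by rwa [one_mul])
    rw [one_mul, (sum_caWeights a).1] at hexp
    exact (Int.modEq_iff_dvd.2 (by rwa [sub_neg_eq_add, add_comm])).symm
  · refine (Int.modEq_iff_dvd.2 ?_).symm
    have := dvd_sub (dvd_add_sub_one_ca hadm hi) h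
    rwa [show a i + a i' - 1 - a i = a i' - 1 by ring] at this

lemma not_dvd_of_not_modEq_ca {k r e : ℕ} {a : Fin 4 → ℕ} {S : Set (Fin 4 → ℕ)}
    (hadm : Admissible k r (fun i => a i) ![1, 1, 0, 0] S)
    (he : (r : ℤ) ∣ ∑ i, ((![1, 1, 0, 0] : Fin 4 → ℕ) i : ℤ) * a i - e)
    (hexclude : ∀ b : ℤ, Int.gcd b r = 1 →
      ¬ ((a 0 : ℤ) ≡ b [ZMOD r] ∧ (a 1 : ℤ) ≡ -b [ZMOD r] ∧ (e : ℤ) ≡ 0 [ZMOD r] ∧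
        (((a 2 : ℤ) ≡ 1 [ZMOD r] ∧ (a 3 : ℤ) ≡ 0 [ZMOD r]) ∨
          ((a 2 : ℤ) ≡ 0 [ZMOD r] ∧ (a 3 : ℤ) ≡ 1 [ZMOD r])))) :
    ¬ (r : ℤ) ∣ a 2 ∧ ¬ (r : ℤ) ∣ a 3 := by
  have he₀ (h₁ : (a 1 : ℤ) ≡ -a 0 [ZMOD r]) : (e : ℤ) ≡ 0 [ZMOD r] := by
    have hsum : ∑ i, ((![1, 1, 0, 0] : Fin 4 → ℕ) i : ℤ) * a i = a 0 + a 1 := by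
      simp [Fin.sum_univ_four]
    rw [hsum] at he
    calc (e : ℤ) ≡ a 0 + a 1 [ZMOD r] := Int.modEq_iff_dvd.2 he
      _ ≡ a 0 + -a 0 [ZMOD r] := h₁.add_left _
      _ = 0 := add_neg_cancel _
  constructor
  · intro h
    obtain ⟨hgcd, h₁, h₂, h₃⟩ := modEq_of_dvd_ca hadm (Or.inl ⟨rfl, rfl⟩) h
    exact hexclude _ hgcd ⟨rfl, h₁, he₀ h₁, Or.inr ⟨h₂, h₃⟩⟩
  · intro h
    obtain ⟨hgcd, h₁, h₃, h₂⟩ := modEq_of_dvd_ca hadm (Or.inr ⟨rfl, rfl⟩) h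
    exact hexclude _ hgcd ⟨rfl, h₁, he₀ h₁, Or.inl ⟨h₂, h₃⟩⟩

end Bound

end EncCDV

open EncCDV in
theorem theorem1p2_general (k : ℕ) :
    ∃ R : ℕ, ∀ (r : ℕ) (a : Fin 4 → ℕ) (e : ℕ) (ξ : ℂ) (f : ConvergentSeries)
      (X : Finset (Fin 4 → ℚ)), 0 < r → (∀ i, Nat.gcd (a i) r ∣ Nat.gcd e r) →
      (∀ i j, i < j → Nat.gcd (Nat.gcd (a i) (a j)) r = 1) →
      (∑ i, (a i : ℤ)) - e ≡ 1 [ZMOD r] → IsPrimitiveRoot ξ r → IsSemiInvariant ξ a e f →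
      (IsCAType f ∨ IsSumSqType f ∨ IsCDEType f) →
      (IsCAType f → ∀ b : ℤ, Int.gcd b r = 1 →
        ¬ ((a 0 : ℤ) ≡ b [ZMOD r] ∧ (a 1 : ℤ) ≡ -b [ZMOD r] ∧ (e : ℤ) ≡ 0 [ZMOD r] ∧
          (((a 2 : ℤ) ≡ 1 [ZMOD r] ∧ (a 3 : ℤ) ≡ 0 [ZMOD r]) ∨
            ((a 2 : ℤ) ≡ 0 [ZMOD r] ∧ (a 3 : ℤ) ≡ 1 [ZMOD r])))) →
      X.card ≤ k → (∀ α ∈ weights r a, α ∉ X → 1 < gap α f) → r ≤ R := by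
  obtain ⟨R₁, hR₁⟩ := exists_bound_ca k
  obtain ⟨R₂, hR₂⟩ := exists_bound_sumSq k
  obtain ⟨R₃, hR₃⟩ := exists_bound_cde k
  refine ⟨max R₁ (max R₂ R₃), ?_⟩
  intro r a e ξ f X hr hgcd hpair hsum hξ hf htype hexclude hX hgap
  have hadm {n₀ : Fin 4 → ℕ} (hn₀ : n₀ ∈ exponents f) :=
    admissible_of_one_lt_gap hr hgcd hpair hsum hξ hf hX hgap hn₀
  have hsq : (fun i => ((Pi.single 0 2 : Fin 4 → ℕ) i : ℤ)) = Pi.single 0 2 := by decide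
  rcases htype with hca | hsumSq | hcde
  · have hca_adm := hadm hca.mem_exponents
    rw [show (fun i => ((![1, 1, 0, 0] : Fin 4 → ℕ) i : ℤ)) = ![1, 1, 0, 0] by decide] at hca_adm
    exact le_max_of_le_left (hR₁ _ _ _ ⟨hca_adm, hca.exponents_subset,
      not_dvd_of_not_modEq_ca hca_adm (dvd_sum_sub_of_mem_exponents hξ hr hf hca.mem_exponents)
        (hexclude hca)⟩)
  · exact le_max_of_le_right (le_max_of_le_left (hR₂ _ _ _
      ⟨hsq ▸ hadm hsumSq.mem_exponents.1, hsumSq.exponents_subset, hsumSq.mem_exponents.2⟩))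
  · exact le_max_of_le_right (le_max_of_le_right (hR₃ _ _ _
      ⟨hsq ▸ hadm hcde.mem_exponents, hcde.exponents_subset⟩))

theorem theorem1p2 (k : ℕ) (hk : 1 ≤ k) :
    ∃ (Γr : Finset ℕ) (Γβ : Finset (Fin 4 → ℚ)),
      ∀ (r : ℕ) (a : Fin 4 → ℕ) (e : ℕ) (ξ : ℂ) (f : EncCDV.ConvergentSeries) (β : Fin 4 → ℚ),
        EncCDV.EncSetting k r a e ξ f β → r ∈ Γr ∨ (β ≠ 0 ∧ β ∈ Γβ) := by
  obtain ⟨R, hR⟩ := theorem1p2_general k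
  refine ⟨Finset.range (R + 1), ∅, fun r a e ξ f β h => Or.inl (Finset.mem_range_succ_iff.2 ?_)⟩
  obtain ⟨X, hX, hgap⟩ := h.inequalities.exists_exceptions
  exact hR r a e ξ f X h.r_pos h.gcd_dvd h.gcd_pair h.sum_sub h.primitiveRoot h.semiInvariant
    (h.type.imp_right (Or.imp_left And.left)) h.exclude hX hgap
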